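/- Let $\kappa,m$ be natural numbers, $A\in\mathbb{R}^{m\times m}$, and let $\{x_k\}_{k=1}^{\kappa}$ be the $\mathbb{R}^m$-valued Gauss–Markov process $x_{k+1}=Ax_k+w_k$, where $x_1\sim\mathbb{N}(0,\Sigma_1)$ and $w_k\sim\mathbb{N}(0,\Sigma_w)$ are mutually independent; no covariance is assumed invertible. Put $\Sigma_k:=\mathrm{cov}\{x_k\}$. A signaling policy $\eta_{1:\kappa}$ is a sequence of stochastic kernels, where $\eta_k$ draws the signal $s_k$ given $x_{1:k}$ (and possibly the earlier signals $s_{1:k-1}$). Write $H_k(\eta):=\mathrm{cov}\{\mathbb{E}\{x_k\mid s_{1:k}\}\}$. For symmetric matrices, $X\succeq Y$ means that $X-Y$ is positive semi-definite. Let $\Upsilon$ be the set of policies whose signals are second-order random vectors in $\mathbb{R}^m$. (i) For every signaling policy (with signals in any measurable space), $\Sigma_1\succeq H_1(\eta)\succeq O$ and $\Sigma_k\succeq H_k(\eta)\succeq AH_{k-1}(\eta)A'$ for $k=2,\ldots,\kappa$. (ii) Conversely, let $H_1,\ldots,H_\kappa$ be symmetric $m\times m$ matrices with $$\Sigma_k\succeq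 H_k\succeq AH_{k-1}A',\quad k=1,\ldots,\kappa,\qquad H_0:=O. \tag{$*$}$$ Then there are $L_k\in\mathbb{R}^{m\times m}$ and $\Sigma_k^o\succeq O$ such that the memoryless policy $s_k=L_k'x_k+\nu_k$, where $\nu_k\sim\mathbb{N}(0,\Sigma_k^o)$ are independent of each other and of $\{x_k\}$, belongs to $\Upsilon$ and satisfies $\mathrm{cov}\{\mathbb{E}\{x_k\mid s_{1:k}\}\}=H_k$ for all $k$. Explicitly: for each $k$ there are $0\le n_k\le m$, an orthogonal $U_k\in\mathbb{R}^{m\times m}$ and a positive definite diagonal $\Lambda_k\in\mathbb{R}^{n_k\times n_k}$ with $$\Sigma_k-AH_{k-1}A'=U_k\begin{bmatrix}\Lambda_k&O\\O&O\end{bmatrix}U_k',$$ and an orthogonal $\bar U_k$ and a diagonal $\bar\Lambda_k=\mathrm{diag}\{\bar\lambda_{k,1},\ldots,\bar\lambda_{k,n_k}\}$ with $$\begin{bmatrix}\Lambda_k^{-1/2}&O\end{bmatrix}U_k'(H_k-AH_{k-1}A')U_k\begin{bmatrix}\Lambda_k^{-1/2}\\O\end{bmatrix}=\bar U_k\bar\Lambda_k\bar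 U_k'.$$ For any such decompositions all $\bar\lambda_{k,i}\in[0,1]$, and for any reals $\lambda^o_{k,i},\sigma^o_{k,i}$, not both zero, with $$\frac{(\lambda^o_{k,i})^2}{(\lambda^o_{k,i})^2+(\sigma^o_{k,i})^2}=\bar\lambda_{k,i},\qquad i=1,\ldots,n_k,$$ one may take $$L_k=U_k\begin{bmatrix}I_{n_k}\\O\end{bmatrix}\Lambda_k^{-1/2}\bar U_k\,\mathrm{diag}\{\lambda^o_{k,1},\ldots,\lambda^o_{k,n_k}\}\begin{bmatrix}I_{n_k}&O\end{bmatrix},\qquad \Sigma_k^o=\mathrm{diag}\{(\sigma^o_{k,1})^2,\ldots,(\sigma^o_{k,n_k})^2,0,\ldots,0\}.$$ (iii) Consequently $\{H_{1:\kappa}(\eta):\eta\in\Upsilon\}$ is exactly the set of sequences satisfying $(*)$. Moreover, for all matrices $Q,K\in\mathbb{R}^{p\times m}$ and $V:=K'K-K'Q-Q'K$, each $\eta\in\Upsilon$ has cost $$\sum_{k=1}^{\kappa}\mathbb{E}\|Qx_k-K\,\mathbb{E}\{x_k\mid s_{1:k}\}\|^2=\sum_{k=1}^{\kappa}\mathrm{Tr}\{H_k(\eta)V\}+\sum_{k=1}^{\kappa}\mathrm{Tr}\{Q'Q\Sigma_k\};$$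 $\eta\in\Upsilon$ minimizes this cost over $\Upsilon$ if and only if $H_{1:\kappa}(\eta)$ minimizes $\sum_k\mathrm{Tr}\{H_kV\}$ subject to $(*)$; and some policy of the form $s_k=L_k'x_k+\nu_k$ as above attains the minimum over $\Upsilon$. -/

import Mathlib

open MeasureTheory ProbabilityTheory Matrix

noncomputable section

/-- The value of a stage-indexed family at the previous stage; it is `0` at the first stage. -/
def prev {κ : ℕ} {M : Type*} [Zero M] (f : Fin κ → M) (k : Fin κ) : M :=
  if h : 0 < k.val then f ⟨k.val - 1, by omega⟩ else 0

/-- The driving terms of the recursion `x_{k+1} = A x_k + w_k`: at the first stage this is the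
initial state, at a later stage it is `x_{k+1} - A x_k`, that is, `w_k`. -/
def innovation {Ω : Type*} {m κ : ℕ} (A : Matrix (Fin m) (Fin m) ℝ)
    (x : Fin κ → Ω → EuclideanSpace ℝ (Fin m)) (k : Fin κ) (ω : Ω) : EuclideanSpace ℝ (Fin m) :=
  x k ω - A.toEuclideanLin (prev x k ω)

/-- `x` is a Gauss–Markov process: `x_{k+1} = A x_k + w_k`, the initial state is `N(0, S₁)`, each
`w_k` is `N(0, Sw)`, and the initial state and all the `w_k` are independent. -/
structure IsGaussMarkov {Ω : Type*} [MeasurableSpace Ω] {m κ : ℕ} (P : Measure Ω)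
    (A S₁ Sw : Matrix (Fin m) (Fin m) ℝ) (x : Fin κ → Ω → EuclideanSpace ℝ (Fin m)) : Prop where
  measurable : ∀ k, Measurable (x k)
  posSemidef_init : S₁.PosSemidef
  posSemidef_noise : Sw.PosSemidef
  law_init : ∀ k : Fin κ, k.val = 0 → P.map (innovation A x k) = multivariateGaussian 0 S₁
  law_noise : ∀ k : Fin κ, k.val ≠ 0 → P.map (innovation A x k) = multivariateGaussian 0 Sw
  indep : iIndepFun (innovation A x) P

/-- The covariance matrix of a random vector. -/
def covMat {Ω : Type*} [MeasurableSpace Ω] {m : ℕ} (P : Measure Ω)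
    (y : Ω → EuclideanSpace ℝ (Fin m)) : Matrix (Fin m) (Fin m) ℝ :=
  Matrix.of fun i j => cov[fun ω => y ω i, fun ω => y ω j; P]

/-- The σ-algebra generated by the signals sent up to stage `k`. -/
abbrev signalSigma {Ω 𝒮 : Type*} [MeasurableSpace 𝒮] {κ : ℕ} (s : Fin κ → Ω → 𝒮) (k : Fin κ) :
    MeasurableSpace Ω :=
  MeasurableSpace.comap (fun ω (j : Set.Iic k) => s j ω) inferInstance

/-- The posterior estimate `E{x_k | s_{1:k}}`. -/
def posterior {Ω 𝒮 : Type*} [MeasurableSpace Ω] [MeasurableSpace 𝒮] {m κ : ℕ} (P : Measure Ω)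
    (x : Fin κ → Ω → EuclideanSpace ℝ (Fin m)) (s : Fin κ → Ω → 𝒮) (k : Fin κ) :
    Ω → EuclideanSpace ℝ (Fin m) :=
  P[x k | signalSigma s k]

/-- The covariance `cov{E{x_k | s_{1:k}}}` of the posterior estimate. -/
def posteriorCov {Ω 𝒮 : Type*} [MeasurableSpace Ω] [MeasurableSpace 𝒮] {m κ : ℕ} (P : Measure Ω)
    (x : Fin κ → Ω → EuclideanSpace ℝ (Fin m)) (s : Fin κ → Ω → 𝒮) (k : Fin κ) :
    Matrix (Fin m) (Fin m) ℝ :=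
  covMat P (posterior P x s k)

/-- A signaling policy with signals in `𝒮`: at each stage a stochastic kernel which draws the
signal given the states up to that stage (and, as the sender recalls them, the signals already
sent; a rule may of course ignore them). With `k` counted from `0`, the states known at stage `k`
are indexed by `Fin (k + 1)` and the earlier signals by `Fin k`. -/
structure SignalingPolicy (m κ : ℕ) (𝒮 : Type*) [MeasurableSpace 𝒮] where
  kernel : ∀ k : Fin κ,
    Kernel ((Fin (k.val + 1) → EuclideanSpace ℝ (Fin m)) × (Fin k.val → 𝒮)) 𝒮
  isMarkovKernel : ∀ k, IsMarkovKernel (kernel k)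

/-- The conditional law of the signals given the states, when the signals are drawn one after the
other from the given kernels. -/
def signalKernel {E 𝒮 : Type*} [MeasurableSpace E] [MeasurableSpace 𝒮] : (n : ℕ) →
    (∀ k : Fin n, Kernel ((Fin (k.val + 1) → E) × (Fin k.val → 𝒮)) 𝒮) →
    Kernel (Fin n → E) (Fin n → 𝒮)
  | 0, _ => Kernel.const _ (Measure.dirac Fin.elim0)
  | n + 1, η =>
    Kernel.map
      (Kernel.compProd
        ((signalKernel n fun k => η k.castSucc).comap
          (fun (x : Fin (n + 1) → E) (j : Fin n) => x j.castSucc) (by fun_prop))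
        (η (Fin.last n) : Kernel ((Fin (n + 1) → E) × (Fin n → 𝒮)) 𝒮))
      (fun q (j : Fin (n + 1)) => if h : j.val < n then q.1 ⟨j.val, h⟩ else q.2)

namespace SignalingPolicy

/-- The joint law of the states and the signals under a policy. -/
def jointLaw {Ω 𝒮 : Type*} [MeasurableSpace Ω] [MeasurableSpace 𝒮] {m κ : ℕ}
    (η : SignalingPolicy m κ 𝒮) (P : Measure Ω) (x : Fin κ → Ω → EuclideanSpace ℝ (Fin m)) :
    Measure ((Fin κ → EuclideanSpace ℝ (Fin m)) × (Fin κ → 𝒮)) :=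
  (P.map fun ω k => x k ω).compProd (signalKernel κ η.kernel)

/-- The posterior estimate `E{x_k | s_{1:k}}` under a policy. -/
def estimate {Ω 𝒮 : Type*} [MeasurableSpace Ω] [MeasurableSpace 𝒮] {m κ : ℕ}
    (η : SignalingPolicy m κ 𝒮) (P : Measure Ω) (x : Fin κ → Ω → EuclideanSpace ℝ (Fin m))
    (k : Fin κ) : (Fin κ → EuclideanSpace ℝ (Fin m)) × (Fin κ → 𝒮) → EuclideanSpace ℝ (Fin m) :=
  posterior (η.jointLaw P x) (fun k p => p.1 k) (fun k p => p.2 k) k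

/-- The covariance `cov{E{x_k | s_{1:k}}}` of the posterior estimate under a policy. -/
def estimateCov {Ω 𝒮 : Type*} [MeasurableSpace Ω] [MeasurableSpace 𝒮] {m κ : ℕ}
    (η : SignalingPolicy m κ 𝒮) (P : Measure Ω) (x : Fin κ → Ω → EuclideanSpace ℝ (Fin m))
    (k : Fin κ) : Matrix (Fin m) (Fin m) ℝ :=
  posteriorCov (η.jointLaw P x) (fun k p => p.1 k) (fun k p => p.2 k) k

/-- The sender's expected quadratic cost `∑ k, E ‖Q x_k - K E{x_k | s_{1:k}}‖²`. -/
def cost {Ω 𝒮 : Type*} [MeasurableSpace Ω] [MeasurableSpace 𝒮] {m κ p : ℕ}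
    (P : Measure Ω) (x : Fin κ → Ω → EuclideanSpace ℝ (Fin m))
    (Q K : Matrix (Fin p) (Fin m) ℝ) (η : SignalingPolicy m κ 𝒮) : ℝ :=
  ∑ k, ∫ z, ‖Q.toEuclideanLin (z.1 k) - K.toEuclideanLin (η.estimate P x k z)‖ ^ 2
    ∂(η.jointLaw P x)

end SignalingPolicy

/-- The sender's policies: signals in `ℝ^m` that are second-order random vectors. -/
def policies {Ω : Type*} [MeasurableSpace Ω] {m κ : ℕ} (P : Measure Ω)
    (x : Fin κ → Ω → EuclideanSpace ℝ (Fin m)) :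
    Set (SignalingPolicy m κ (EuclideanSpace ℝ (Fin m))) :=
  {η | ∀ k, MemLp (fun z => z.2 k) 2 (η.jointLaw P x)}

/-- The memoryless linear rules `s_k = L_k' x_k + n_k`, where `n_k` is drawn from `N(0, N_k)`
independently of everything else. -/
def linearPolicy {m κ : ℕ} (L N : Fin κ → Matrix (Fin m) (Fin m) ℝ) :
    SignalingPolicy m κ (EuclideanSpace ℝ (Fin m)) where
  kernel k :=
    (Kernel.prod Kernel.id (Kernel.const _ (multivariateGaussian 0 (N k)))).map
      fun q => (L k)ᵀ.toEuclideanLin (q.1.1 (Fin.last k.val)) + q.2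
  isMarkovKernel k := by
    apply Kernel.IsMarkovKernel.map
    have h : Measurable fun v : EuclideanSpace ℝ (Fin m) => (L k)ᵀ.toEuclideanLin v :=
      (LinearMap.continuous_of_finiteDimensional _).measurable
    fun_prop

/-- The memoryless linear rules with gains `L` and noise covariances `N` (which are positive
semidefinite) attain the sequence `H` of covariances of the posterior estimate: as a policy, and
also for any noise vectors `n_k` of law `N(0, N_k)` that are given on the space of the states, are
independent of each other and are independent of the states. -/
structure LinearRuleAttains {Ω : Type*} [MeasurableSpace Ω] {m κ : ℕ} (P : Measure Ω)
    (x : Fin κ → Ω → EuclideanSpace ℝ (Fin m)) (L N H : Fin κ → Matrix (Fin m) (Fin m) ℝ) :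
    Prop where
  posSemidef : ∀ k, (N k).PosSemidef
  mem_policies : linearPolicy L N ∈ policies P x
  estimateCov_eq : ∀ k, (linearPolicy L N).estimateCov P x k = H k
  posteriorCov_eq : ∀ n : Fin κ → Ω → EuclideanSpace ℝ (Fin m), (∀ k, Measurable (n k)) →
    (∀ k, P.map (n k) = multivariateGaussian 0 (N k)) → iIndepFun n P →
    IndepFun (fun ω k => n k ω) (fun ω k => x k ω) P →
    ∀ k, posteriorCov P x (fun j ω => (L j)ᵀ.toEuclideanLin (x j ω) + n j ω) k = H k

/-- The sequences `H` with `S_k ⪰ H_k ⪰ A H_{k-1} A'`, where `H_0 = 0`. -/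
def feasible {m κ : ℕ} (A : Matrix (Fin m) (Fin m) ℝ) (S : Fin κ → Matrix (Fin m) (Fin m) ℝ) :
    Set (Fin κ → Matrix (Fin m) (Fin m) ℝ) :=
  {H | ∀ k, (S k - H k).PosSemidef ∧ (H k - A * prev H k * Aᵀ).PosSemidef}

/-- The `m × m` diagonal matrix with the entries of `v` followed by zeros. -/
def padDiagonal (m : ℕ) {n : ℕ} (v : Fin n → ℝ) : Matrix (Fin m) (Fin m) ℝ :=
  Matrix.diagonal fun i => if h : i.val < n then v ⟨i.val, h⟩ else 0

/-- The `m × n` matrix `[I; O]`. -/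
def idZero (m n : ℕ) : Matrix (Fin m) (Fin n) ℝ :=
  Matrix.of fun i j => if i.val = j.val then 1 else 0

/-- The data `(n, U, Λ, Ū, Λ̄)` of the two eigen-decompositions at one stage. -/
structure EigenData (m : ℕ) where
  n : ℕ
  n_le : n ≤ m
  U : Matrix (Fin m) (Fin m) ℝ
  lam : Fin n → ℝ
  Ubar : Matrix (Fin n) (Fin n) ℝ
  lamBar : Fin n → ℝ

namespace EigenData

/-- The diagonal matrix `Λ^{-1/2}`. -/
def invSqrt {m : ℕ} (D : EigenData m) : Matrix (Fin D.n) (Fin D.n) ℝ :=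
  Matrix.diagonal fun i => (√(D.lam i))⁻¹

/-- The compression `[Λ^{-1/2} O] U' G U [Λ^{-1/2}; O]` of a symmetric matrix `G`. -/
def compress {m : ℕ} (D : EigenData m) (G : Matrix (Fin m) (Fin m) ℝ) :
    Matrix (Fin D.n) (Fin D.n) ℝ :=
  (D.invSqrt * (idZero m D.n)ᵀ) * D.Uᵀ * G * D.U * (idZero m D.n * D.invSqrt)

/-- `R = U [Λ O; O O] U'` with `U` orthogonal and `Λ` diagonal and positive definite, and
`[Λ^{-1/2} O] U' G U [Λ^{-1/2}; O] = Ū Λ̄ Ū'` with `Ū` orthogonal and `Λ̄` diagonal. -/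
structure Decomposes {m : ℕ} (D : EigenData m) (R G : Matrix (Fin m) (Fin m) ℝ) : Prop where
  orthogonal : D.U ∈ Matrix.orthogonalGroup (Fin m) ℝ
  lam_pos : ∀ i, 0 < D.lam i
  eq : R = D.U * padDiagonal m D.lam * D.Uᵀ
  orthogonal_bar : D.Ubar ∈ Matrix.orthogonalGroup (Fin D.n) ℝ
  compress_eq : D.compress G = D.Ubar * Matrix.diagonal D.lamBar * D.Ubarᵀ

/-- The gain `L = U [I; O] Λ^{-1/2} Ū Λᵒ [I O]`. -/
def gain {m : ℕ} (D : EigenData m) (lamO : Fin D.n → ℝ) : Matrix (Fin m) (Fin m) ℝ :=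
  D.U * idZero m D.n * D.invSqrt * D.Ubar * Matrix.diagonal lamO * (idZero m D.n)ᵀ

/-- The noise covariance `diag(σ₁², …, σₙ², 0, …, 0)`. -/
def noiseCov {m : ℕ} (D : EigenData m) (sigO : Fin D.n → ℝ) : Matrix (Fin m) (Fin m) ℝ :=
  padDiagonal m fun i => sigO i ^ 2

end EigenData

/-- The objective `∑ k, Tr(H_k V)` of the semidefinite program. -/
def sdpObjective {m κ : ℕ} (V : Matrix (Fin m) (Fin m) ℝ)
    (H : Fin κ → Matrix (Fin m) (Fin m) ℝ) : ℝ :=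
  ∑ k, (H k * V).trace

end

/-! Necessity. Write the state as `A` times the previous state plus an innovation. Earlier signals
are drawn from earlier states, so the innovation is independent of them
(`map_restrict_signalKernel_congr`, `indepFun_compProd`). By the tower property the current
posterior, conditioned on the earlier signals, is a constant plus `A` times the previous posterior.
Conditioning can only lower a covariance in the Loewner order; applied to the state and to its
posterior, this gives the two inequalities (`posteriorCov_mem_feasible`).

Sufficiency. Let R = Σ_k - A H_{k-1} A' be the covariance of the prediction error and G = H_k - A
H_{k-1} A' the covariance increment to be produced, so that O ⪯ G ⪯ R. A linear rule with gain L and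
noise covariance N leads to a Kalman recursion with estimator gain M as soon as R L = M (L' R L +
N), and the increment is then R L M' (`exists_estimate_step`). Since everything is jointly Gaussian,
an error uncorrelated with the signals is independent of them, so the linear estimate is the
posterior up to a constant (`posteriorCov_linear`). To realize a given G, factor R = F F'. Because
ker R ⊆ ker G, G = F Ū Λ̄ Ū' F' (`mul_transpose_eq`). In the whitened coordinates the rule measures
each eigendirection of Ū separately with gain λ° and noise σ°, and recovers the fraction λ°²/(λ°² +
σ°²) of its variance. All matrices to be inverted are then diagonal, and no covariance has to be
invertible (`mul_gain_eq`, `mul_gain_mul_estimatorGain`).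

Optimization. The orthogonality of the estimation error makes the cost an affine function of the
posterior covariances (`integral_norm_sq_sub_condExp`). These fill out the feasible set exactly, and
that set is compact (`isCompact_feasible`), so a minimizer exists and is realized by a linear rule.
-/

/-! ### Cross-covariance calculus for random vectors. -/

section CrossCov

variable {Ω : Type*} [MeasurableSpace Ω] {P : Measure Ω} {l m n : ℕ}

/-- The cross-covariance matrix of two random vectors. -/
noncomputable def crossCov (P : Measure Ω) (y : Ω → EuclideanSpace ℝ (Fin m))
    (z : Ω → EuclideanSpace ℝ (Fin n)) : Matrix (Fin m) (Fin n) ℝ :=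
  Matrix.of fun i j => cov[fun ω => y ω i, fun ω => z ω j; P]

lemma covMat_eq_crossCov (y : Ω → EuclideanSpace ℝ (Fin m)) : covMat P y = crossCov P y y := rfl

lemma toEuclideanLin_coord (M : Matrix (Fin l) (Fin m) ℝ) (v : EuclideanSpace ℝ (Fin m))
    (i : Fin l) : M.toEuclideanLin v i = ∑ j, M i j * v j := by
  simp [Matrix.toLpLin_apply, Matrix.mulVec, dotProduct]

lemma measurable_toEuclideanLin (M : Matrix (Fin l) (Fin m) ℝ) :
    Measurable fun v : EuclideanSpace ℝ (Fin m) => M.toEuclideanLin v :=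
  (LinearMap.continuous_of_finiteDimensional _).measurable

lemma MeasureTheory.MemLp.coord {y : Ω → EuclideanSpace ℝ (Fin m)} (hy : MemLp y 2 P) (i : Fin m) :
    MemLp (fun ω => y ω i) 2 P :=
  (EuclideanSpace.proj (𝕜 := ℝ) i).comp_memLp' hy

lemma MeasureTheory.MemLp.toEuclideanLin (M : Matrix (Fin l) (Fin m) ℝ)
    {y : Ω → EuclideanSpace ℝ (Fin m)} (hy : MemLp y 2 P) :
    MemLp (fun ω => M.toEuclideanLin (y ω)) 2 P :=
  (LinearMap.toContinuousLinearMap M.toEuclideanLin).comp_memLp' hy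

lemma crossCov_transpose (y : Ω → EuclideanSpace ℝ (Fin m)) (z : Ω → EuclideanSpace ℝ (Fin n)) :
    (crossCov P y z)ᵀ = crossCov P z y := by
  ext i j
  exact covariance_comm _ _

variable {y y' : Ω → EuclideanSpace ℝ (Fin m)} {z z' : Ω → EuclideanSpace ℝ (Fin n)}

lemma crossCov_congr (hy : y =ᵐ[P] y') (hz : z =ᵐ[P] z') :
    crossCov P y z = crossCov P y' z' := by
  ext i j
  have h1 : ∫ ω, y ω i ∂P = ∫ ω, y' ω i ∂P := integral_congr_ae (hy.mono fun ω h => by simp only [h])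
  have h2 : ∫ ω, z ω j ∂P = ∫ ω, z' ω j ∂P := integral_congr_ae (hz.mono fun ω h => by simp only [h])
  simp only [crossCov, Matrix.of_apply, covariance, h1, h2]
  refine integral_congr_ae ?_
  filter_upwards [hy, hz] with ω ha hb
  rw [ha, hb]

lemma covMat_congr (hy : y =ᵐ[P] y') : covMat P y = covMat P y' := crossCov_congr hy hy

lemma crossCov_map {Ω' : Type*} [MeasurableSpace Ω'] {T : Ω' → Ω} {Q : Measure Ω'}
    (hT : Measurable T) (hy : Measurable y) (hz : Measurable z) :
    crossCov (Q.map T) y z = crossCov Q (fun ω => y (T ω)) (fun ω => z (T ω)) := by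
  ext i j
  exact covariance_map (by fun_prop) (by fun_prop) (by fun_prop)

variable [IsProbabilityMeasure P]

lemma crossCov_add_left (hy : MemLp y 2 P) (hy' : MemLp y' 2 P) (hz : MemLp z 2 P) :
    crossCov P (fun ω => y ω + y' ω) z = crossCov P y z + crossCov P y' z := by
  ext i j
  exact covariance_add_left (hy.coord i) (hy'.coord i) (hz.coord j)

lemma crossCov_sub_left (hy : MemLp y 2 P) (hy' : MemLp y' 2 P) (hz : MemLp z 2 P) :
    crossCov P (fun ω => y ω - y' ω) z = crossCov P y z - crossCov P y' z := by
  ext i j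
  exact covariance_sub_left (hy.coord i) (hy'.coord i) (hz.coord j)

lemma crossCov_add_right (hy : MemLp y 2 P) (hz : MemLp z 2 P) (hz' : MemLp z' 2 P) :
    crossCov P y (fun ω => z ω + z' ω) = crossCov P y z + crossCov P y z' := by
  ext i j
  exact covariance_add_right (hy.coord i) (hz.coord j) (hz'.coord j)

lemma crossCov_sub_right (hy : MemLp y 2 P) (hz : MemLp z 2 P) (hz' : MemLp z' 2 P) :
    crossCov P y (fun ω => z ω - z' ω) = crossCov P y z - crossCov P y z' := by
  ext i j
  exact covariance_sub_right (hy.coord i) (hz.coord j) (hz'.coord j)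

lemma crossCov_lin_left (M : Matrix (Fin l) (Fin m) ℝ) (hy : MemLp y 2 P) (hz : MemLp z 2 P) :
    crossCov P (fun ω => M.toEuclideanLin (y ω)) z = M * crossCov P y z := by
  ext i j
  simp only [crossCov, Matrix.of_apply, Matrix.mul_apply, toEuclideanLin_coord]
  rw [covariance_fun_sum_left (fun k => (hy.coord k).const_mul (M i k)) (hz.coord j)]
  simp_rw [covariance_const_mul_left]

lemma crossCov_lin_right (M : Matrix (Fin l) (Fin n) ℝ) (hy : MemLp y 2 P) (hz : MemLp z 2 P) :
    crossCov P y (fun ω => M.toEuclideanLin (z ω)) = crossCov P y z * Mᵀ := by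
  rw [← crossCov_transpose, crossCov_lin_left M hz hy, Matrix.transpose_mul, crossCov_transpose]

lemma covMat_lin (M : Matrix (Fin l) (Fin m) ℝ) (hy : MemLp y 2 P) :
    covMat P (fun ω => M.toEuclideanLin (y ω)) = M * covMat P y * Mᵀ := by
  rw [covMat_eq_crossCov, crossCov_lin_left M hy (hy.toEuclideanLin M), crossCov_lin_right M hy hy,
    covMat_eq_crossCov, Matrix.mul_assoc]

omit [IsProbabilityMeasure P] in
lemma crossCov_eq_zero_of_indepFun (h : IndepFun y z P) (hy : MemLp y 2 P) (hz : MemLp z 2 P) :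
    crossCov P y z = 0 := by
  ext i j
  have h' : IndepFun (fun ω => y ω i) (fun ω => z ω j) P :=
    h.comp (φ := fun v : EuclideanSpace ℝ (Fin m) => v i)
      (ψ := fun v : EuclideanSpace ℝ (Fin n) => v j) (by fun_prop) (by fun_prop)
  exact h'.covariance_eq_zero (hy.coord i) (hz.coord j)

/-- An independent summand contributes only its mean to a conditional expectation. Discarding
constants here spares both covariance arguments from showing that this mean vanishes. -/
lemma covMat_const_add (c : EuclideanSpace ℝ (Fin m)) (hy : MemLp y 2 P) :
    covMat P (fun ω => c + y ω) = covMat P y := by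
  ext i j
  have h : ∀ i, Integrable (fun ω => y ω i) P := fun i => (hy.coord i).integrable (by norm_num)
  simp only [covMat, Matrix.of_apply, PiLp.add_apply]
  rw [covariance_const_add_left (h i), covariance_const_add_right (h j)]

lemma dotProduct_crossCov_mulVec (hy : MemLp y 2 P) (hz : MemLp z 2 P) (u : Fin m → ℝ)
    (v : Fin n → ℝ) :
    u ⬝ᵥ crossCov P y z *ᵥ v = cov[fun ω => ∑ i, u i * y ω i, fun ω => ∑ j, v j * z ω j; P] := by
  rw [covariance_fun_sum_fun_sum (fun i => (hy.coord i).const_mul (u i))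
    (fun j => (hz.coord j).const_mul (v j))]
  simp_rw [covariance_const_mul_left, covariance_const_mul_right, dotProduct, Matrix.mulVec,
    dotProduct, Finset.mul_sum]
  refine Finset.sum_congr rfl fun i _ => Finset.sum_congr rfl fun j _ => ?_
  simp only [crossCov, Matrix.of_apply]
  ring

/-- Passes from coordinates to continuous functionals, the form in which the Gaussian independence
criterion asks for uncorrelatedness. -/
lemma covariance_dual_eq_zero (h : crossCov P y z = 0) (hy : MemLp y 2 P) (hz : MemLp z 2 P)
    (f : StrongDual ℝ (EuclideanSpace ℝ (Fin m))) (g : StrongDual ℝ (EuclideanSpace ℝ (Fin n))) :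
    cov[fun ω => f (y ω), fun ω => g (z ω); P] = 0 := by
  have key : ∀ {k : ℕ} (f : StrongDual ℝ (EuclideanSpace ℝ (Fin k))) v,
      f v = ∑ i, f (EuclideanSpace.single i 1) * v i := by
    intro k f v
    conv_lhs => rw [← (EuclideanSpace.basisFun (Fin k) ℝ).sum_repr v]
    simp [map_sum, mul_comm]
  rw [show (fun ω => f (y ω)) = _ from funext fun ω => key f (y ω),
    show (fun ω => g (z ω)) = _ from funext fun ω => key g (z ω), ← dotProduct_crossCov_mulVec hy hz, h]
  simp

lemma dotProduct_covMat_mulVec (hy : MemLp y 2 P) (v : Fin m → ℝ) :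
    v ⬝ᵥ covMat P y *ᵥ v = Var[fun ω => ∑ i, v i * y ω i; P] := by
  rw [covMat_eq_crossCov, dotProduct_crossCov_mulVec hy hy, covariance_self]
  exact (memLp_finsetSum _ fun i _ => (hy.coord i).const_mul (v i)).aestronglyMeasurable.aemeasurable

omit [IsProbabilityMeasure P] in
lemma isHermitian_covMat (y : Ω → EuclideanSpace ℝ (Fin m)) : (covMat P y).IsHermitian := by
  rw [Matrix.IsHermitian, Matrix.conjTranspose_eq_transpose_of_trivial]
  exact crossCov_transpose y y

lemma posSemidef_covMat (hy : MemLp y 2 P) : (covMat P y).PosSemidef := by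
  refine Matrix.PosSemidef.of_dotProduct_mulVec_nonneg (isHermitian_covMat y) fun v => ?_
  rw [star_trivial, dotProduct_covMat_mulVec hy]
  exact variance_nonneg _ _

end CrossCov

/-! ### Conditional expectation as a covariance contraction, and the quadratic cost. -/

section ConditionalCovariance

variable {Ω : Type*} {F : MeasurableSpace Ω} [mΩ : MeasurableSpace Ω] {P : Measure Ω}
  [IsProbabilityMeasure P] {m p : ℕ}

/-- Law of total variance: the difference is the mean of the conditional variance. -/
lemma variance_condExp_le (hF : F ≤ mΩ) {f : Ω → ℝ} (hf : MemLp f 2 P) :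
    Var[P[f | F]; P] ≤ Var[f; P] := by
  rw [← integral_condVar_add_variance_condExp hF hf]
  have h : 0 ≤ᵐ[P] Var[f; P | F] := condExp_nonneg (ae_of_all _ fun ω => sq_nonneg _)
  linarith [integral_nonneg_of_ae h]

lemma posSemidef_covMat_sub {y z : Ω → EuclideanSpace ℝ (Fin m)} (hy : MemLp y 2 P)
    (hz : MemLp z 2 P)
    (h : ∀ v : Fin m → ℝ, Var[fun ω => ∑ i, v i * z ω i; P] ≤ Var[fun ω => ∑ i, v i * y ω i; P]) :
    (covMat P y - covMat P z).PosSemidef := by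
  refine Matrix.PosSemidef.of_dotProduct_mulVec_nonneg
    ((isHermitian_covMat y).sub (isHermitian_covMat z)) fun v => ?_
  rw [star_trivial, Matrix.sub_mulVec, dotProduct_sub, dotProduct_covMat_mulVec hy,
    dotProduct_covMat_mulVec hz]
  linarith [h v]

lemma condExp_coord {y : Ω → EuclideanSpace ℝ (Fin m)} (hy : MemLp y 2 P) (i : Fin m) :
    (fun ω => P[y | F] ω i) =ᵐ[P] P[fun ω => y ω i | F] :=
  (EuclideanSpace.proj (𝕜 := ℝ) i).comp_condExp_comm (hy.integrable (by norm_num))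

/-- Linear functionals commute with conditional expectation, so the Loewner inequality reduces to
the scalar variance inequality in every direction. -/
lemma posSemidef_covMat_sub_condExp (hF : F ≤ mΩ) {y : Ω → EuclideanSpace ℝ (Fin m)}
    (hy : MemLp y 2 P) : (covMat P y - covMat P (P[y | F])).PosSemidef := by
  refine posSemidef_covMat_sub hy (hy.condExp one_le_two) fun v => ?_
  let T : EuclideanSpace ℝ (Fin m) →L[ℝ] ℝ := ∑ i, v i • EuclideanSpace.proj i
  have hT : ∀ w, T w = ∑ i, v i * w i := fun w => by simp [T]
  have h := T.comp_condExp_comm (m := F) (hy.integrable (by norm_num) : Integrable y P)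
  simp only [Function.comp_def, hT] at h
  rw [variance_congr h]
  refine variance_condExp_le hF ?_
  exact memLp_finsetSum _ fun i _ => (hy.coord i).const_mul (v i)

/-- The error `y - P[y | F]` has conditional mean zero, hence is uncorrelated with anything
`F`-measurable, in particular with the estimate. -/
lemma crossCov_condExp (hF : F ≤ mΩ) {y : Ω → EuclideanSpace ℝ (Fin m)} (hy : MemLp y 2 P) :
    crossCov P y (P[y | F]) = covMat P (P[y | F]) := by
  have hc : MemLp (P[y | F]) 2 P := hy.condExp one_le_two
  rw [covMat_eq_crossCov, ← sub_eq_zero, ← crossCov_sub_left hy hc hc]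
  ext i j
  have hd : MemLp (fun ω => y ω i - P[y | F] ω i) 2 P := (hy.coord i).sub (hc.coord i)
  have hdi := hd.integrable (by norm_num)
  have hyi := (hy.coord i).integrable (by norm_num)
  have hci := (hc.coord i).integrable (by norm_num)
  have hz : P[fun ω => y ω i - P[y | F] ω i | F] =ᵐ[P] 0 := by
    have h1 := condExp_sub hyi hci F
    have h2 : P[fun ω => P[y | F] ω i | F] = fun ω => P[y | F] ω i :=
      condExp_of_stronglyMeasurable hF
        ((EuclideanSpace.proj (𝕜 := ℝ) i).continuous.comp_stronglyMeasurable
          stronglyMeasurable_condExp) hci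
    rw [h2] at h1
    refine h1.trans ?_
    filter_upwards [condExp_coord (F := F) hy i] with ω h
    simp only [Pi.sub_apply, Pi.zero_apply, ← h, sub_self]
  have hm : ∫ ω, (y ω i - P[y | F] ω i) ∂P = 0 := by
    rw [← integral_condExp hF, integral_congr_ae hz]
    simp
  have hp : ∫ ω, (y ω i - P[y | F] ω i) * P[y | F] ω j ∂P = 0 := by
    rw [← integral_condExp hF]
    have h := condExp_mul_of_stronglyMeasurable_right
      ((EuclideanSpace.proj (𝕜 := ℝ) j).continuous.comp_stronglyMeasurable
          (stronglyMeasurable_condExp (m := F) (μ := P) (f := y))) (hd.integrable_mul (hc.coord j)) hdi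
    refine (integral_congr_ae (h.trans (hz.mul (Filter.EventuallyEq.refl _ _)))).trans ?_
    simp
  change cov[fun ω => y ω i - P[y | F] ω i, fun ω => P[y | F] ω j; P] = 0
  rw [covariance_eq_sub hd (hc.coord j), hm, zero_mul, sub_zero]
  exact hp

lemma integral_norm_sq_eq_trace {y : Ω → EuclideanSpace ℝ (Fin m)} (hy : MemLp y 2 P)
    (h0 : ∫ ω, y ω ∂P = 0) : ∫ ω, ‖y ω‖ ^ 2 ∂P = (covMat P y).trace := by
  simp_rw [EuclideanSpace.norm_sq_eq, Real.norm_eq_abs, sq_abs]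
  rw [integral_finsetSum _ fun i _ => (hy.coord i).integrable_sq]
  refine Finset.sum_congr rfl fun i _ => ?_
  have h : ∫ ω, y ω i ∂P = 0 := by
    have := (EuclideanSpace.proj (𝕜 := ℝ) i).integral_comp_comm (hy.integrable (by norm_num))
    rw [h0, map_zero] at this
    exact this
  rw [Matrix.diag_apply, covMat, Matrix.of_apply,
    covariance_self (hy.coord i).aestronglyMeasurable.aemeasurable,
    variance_of_integral_eq_zero (hy.coord i).aestronglyMeasurable.aemeasurable h]

/-- The quadratic cost of an estimate in terms of its covariance. -/
lemma integral_norm_sq_sub_condExp (hF : F ≤ mΩ) {y : Ω → EuclideanSpace ℝ (Fin m)}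
    (hy : MemLp y 2 P) (h0 : ∫ ω, y ω ∂P = 0) (Q K : Matrix (Fin p) (Fin m) ℝ) :
    ∫ ω, ‖Q.toEuclideanLin (y ω) - K.toEuclideanLin (P[y | F] ω)‖ ^ 2 ∂P =
      (covMat P (P[y | F]) * (Kᵀ * K - Kᵀ * Q - Qᵀ * K)).trace +
        (Qᵀ * Q * covMat P y).trace := by
  have hc : MemLp (P[y | F]) 2 P := hy.condExp one_le_two
  have hQ := hy.toEuclideanLin Q
  have hK := hc.toEuclideanLin K
  have hQK : MemLp (fun ω => Q.toEuclideanLin (y ω) - K.toEuclideanLin (P[y | F] ω)) 2 P := hQ.sub hK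
  have hi : ∀ {z : Ω → EuclideanSpace ℝ (Fin m)} (M : Matrix (Fin p) (Fin m) ℝ), MemLp z 2 P →
      ∫ ω, z ω ∂P = 0 → ∫ ω, M.toEuclideanLin (z ω) ∂P = 0 := by
    intro z M hz h
    have := (LinearMap.toContinuousLinearMap M.toEuclideanLin).integral_comp_comm
      (hz.integrable (by norm_num))
    rw [h, map_zero] at this
    exact this
  rw [integral_norm_sq_eq_trace hQK]
  · have hs : crossCov P (P[y | F]) y = covMat P (P[y | F]) := by
      rw [← crossCov_transpose, crossCov_condExp hF hy]
      exact crossCov_transpose _ _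
    -- The covariance of the difference expands into four blocks; by orthogonality both mixed blocks
    -- involve only the covariance of the estimate.
    change (crossCov P (fun ω => Q.toEuclideanLin (y ω) - K.toEuclideanLin (P[y | F] ω))
      (fun ω => Q.toEuclideanLin (y ω) - K.toEuclideanLin (P[y | F] ω))).trace = _
    rw [crossCov_sub_left hQ hK hQK, crossCov_sub_right hQ hQ hK,
      crossCov_sub_right hK hQ hK, crossCov_lin_left Q hy hQ, crossCov_lin_left Q hy hK,
      crossCov_lin_left K hc hQ, crossCov_lin_left K hc hK, crossCov_lin_right Q hy hy,
      crossCov_lin_right K hy hc, crossCov_lin_right Q hc hy, crossCov_lin_right K hc hc,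
      crossCov_condExp hF hy, hs, ← covMat_eq_crossCov, ← covMat_eq_crossCov]
    set H := covMat P (P[y | F])
    have cyc : ∀ (M N : Matrix (Fin p) (Fin m) ℝ) (C : Matrix (Fin m) (Fin m) ℝ),
        (M * (C * Nᵀ)).trace = (C * (Nᵀ * M)).trace := by
      intro M N C
      rw [Matrix.trace_mul_comm, Matrix.mul_assoc]
    rw [Matrix.trace_sub, Matrix.trace_sub, Matrix.trace_sub, cyc, cyc, cyc, cyc, Matrix.mul_sub,
      Matrix.mul_sub, Matrix.trace_sub, Matrix.trace_sub, Matrix.trace_mul_comm (Qᵀ * Q)]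
    ring
  · have h0' : ∫ ω, P[y | F] ω ∂P = 0 := by rw [integral_condExp hF, h0]
    change ∫ ω, (Q.toEuclideanLin (y ω) - K.toEuclideanLin (P[y | F] ω)) ∂P = 0
    rw [integral_sub (hQ.integrable (by norm_num)) (hK.integrable (by norm_num)), hi Q hy h0,
      hi K hc h0', sub_zero]

end ConditionalCovariance

/-! ### Signal σ-algebras and the necessary condition. -/

section Necessity

variable {Ω 𝒮 : Type*} [mΩ : MeasurableSpace Ω] [MeasurableSpace 𝒮] {P : Measure Ω} {m κ : ℕ}

lemma signalSigma_le {s : Fin κ → Ω → 𝒮} (hs : ∀ k, Measurable (s k)) (k : Fin κ) :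
    signalSigma s k ≤ mΩ :=
  (measurable_pi_lambda (fun ω (j : Set.Iic k) => s j ω) fun j => hs j).comap_le

omit mΩ in
lemma measurable_signal (s : Fin κ → Ω → 𝒮) {j k : Fin κ} (h : j ≤ k) :
    Measurable[signalSigma s k] (s j) :=
  (measurable_pi_apply (⟨j, h⟩ : Set.Iic k)).comp
    (comap_measurable fun ω (j : Set.Iic k) => s j ω)

omit mΩ in
lemma signalSigma_mono (s : Fin κ → Ω → 𝒮) {j k : Fin κ} (h : j ≤ k) :
    signalSigma s j ≤ signalSigma s k := by
  rw [← measurable_iff_comap_le]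
  exact @measurable_pi_lambda _ _ _ (signalSigma s k) _ (fun ω (i : Set.Iic j) => s i ω)
    fun i => measurable_signal s (le_trans i.2 h)

lemma measurable_innovation (A : Matrix (Fin m) (Fin m) ℝ)
    {x : Fin κ → Ω → EuclideanSpace ℝ (Fin m)} (hx : ∀ k, Measurable (x k)) (k : Fin κ) :
    Measurable (innovation A x k) := by
  refine (hx k).sub ((measurable_toEuclideanLin A).comp ?_)
  unfold prev
  split_ifs
  · exact hx _
  · exact measurable_zero

/-- The necessary condition on the covariances of the posterior estimates: the innovation at each
stage is independent of the earlier signals. -/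
lemma posteriorCov_mem_feasible [IsProbabilityMeasure P] (A : Matrix (Fin m) (Fin m) ℝ)
    {x : Fin κ → Ω → EuclideanSpace ℝ (Fin m)} {s : Fin κ → Ω → 𝒮} (hxm : ∀ k, Measurable (x k))
    (hx : ∀ k, MemLp (x k) 2 P) (hs : ∀ k, Measurable (s k))
    (hind : ∀ k, IndepFun (innovation A x k) (fun ω (j : {j : Fin κ // j < k}) => s j ω) P) :
    posteriorCov P x s ∈ feasible A fun k => covMat P (x k) := by
  intro k
  refine ⟨posSemidef_covMat_sub_condExp (signalSigma_le hs k) (hx k), ?_⟩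
  by_cases hk : 0 < k.val
  · set k' : Fin κ := ⟨k.val - 1, by omega⟩ with hk'
    have hlt : k' < k := by rw [Fin.lt_def]; simp only [hk']; omega
    rw [prev, dif_pos hk]
    have hF := signalSigma_le hs k
    have hF' := signalSigma_le hs k'
    have hpost : MemLp (posterior P x s k') 2 P := (hx k').condExp one_le_two
    have hxi : ∀ ω, x k ω = A.toEuclideanLin (x k' ω) + innovation A x k ω := fun ω => by
      simp only [innovation, prev, dif_pos hk]
      abel
    have hinn : MemLp (innovation A x k) 2 P := by
      have : innovation A x k = fun ω => x k ω - A.toEuclideanLin (x k' ω) := by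
        funext ω
        simp only [innovation, prev, dif_pos hk]
        rfl
      rw [this]
      exact (hx k).sub ((hx k').toEuclideanLin A)
    -- The signals up to `k'` are among those strictly before `k`, hence independent of the
    -- innovation.
    have hindep : Indep (MeasurableSpace.comap (innovation A x k) inferInstance)
        (signalSigma s k') P := by
      have h := (hind k).comp measurable_id
        (ψ := fun (t : {j : Fin κ // j < k} → 𝒮) (i : Set.Iic k') => t ⟨i, lt_of_le_of_lt i.2 hlt⟩)
        (by fun_prop)
      exact (IndepFun_iff_Indep _ _ _).1 h
    have hc : P[innovation A x k | signalSigma s k'] =ᵐ[P] fun _ => P[innovation A x k] :=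
      condExp_indep_eq (measurable_innovation A hxm k).comap_le hF'
        (comap_measurable _).stronglyMeasurable hindep
    have hlin : P[fun ω => A.toEuclideanLin (x k' ω) | signalSigma s k'] =ᵐ[P]
        fun ω => A.toEuclideanLin (posterior P x s k' ω) :=
      ((LinearMap.toContinuousLinearMap A.toEuclideanLin).comp_condExp_comm
        ((hx k').integrable (by norm_num))).symm
    -- Tower property: the smaller σ-algebra sees only the mean of the innovation and `A` times the
    -- previous posterior.
    have hsum : P[P[x k | signalSigma s k] | signalSigma s k'] =ᵐ[P]
        fun ω => P[innovation A x k] + A.toEuclideanLin (posterior P x s k' ω) := by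
      refine (condExp_condExp_of_le (signalSigma_mono s hlt.le) hF).trans ?_
      rw [show x k = (fun ω => A.toEuclideanLin (x k' ω)) + innovation A x k from funext hxi]
      refine (condExp_add (((hx k').toEuclideanLin A).integrable (by norm_num))
        (hinn.integrable (by norm_num)) _).trans ?_
      filter_upwards [hc, hlin] with ω h1 h2
      rw [Pi.add_apply, h1, h2, add_comm]
    -- The contraction is applied to the posterior at stage `k`, not to the state.
    have h := posSemidef_covMat_sub_condExp hF'
      ((hx k).condExp one_le_two : MemLp (P[x k | signalSigma s k]) 2 P)
    rw [covMat_congr hsum, covMat_const_add _ (hpost.toEuclideanLin A), covMat_lin A hpost] at h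
    exact h
  · rw [prev, dif_neg hk, Matrix.mul_zero, Matrix.zero_mul, sub_zero]
    exact posSemidef_covMat ((hx k).condExp one_le_two)

end Necessity

/-! ### Causality of sequentially drawn signals. -/

section Kernels

variable {E 𝒮 : Type*} [MeasurableSpace E] [MeasurableSpace 𝒮]

lemma measurable_append (n : ℕ) :
    Measurable fun (q : (Fin n → 𝒮) × 𝒮) (j : Fin (n + 1)) =>
      if h : j.val < n then q.1 ⟨j.val, h⟩ else q.2 := by
  refine measurable_pi_lambda _ fun j => ?_
  split_ifs <;> fun_prop

lemma isMarkovKernel_signalKernel : ∀ (n : ℕ)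
    (η : ∀ k : Fin n, Kernel ((Fin (k.val + 1) → E) × (Fin k.val → 𝒮)) 𝒮),
    (∀ k, IsMarkovKernel (η k)) → IsMarkovKernel (signalKernel n η)
  | 0, _, _ => by
    rw [signalKernel]
    infer_instance
  | n + 1, η, hη => by
    have := isMarkovKernel_signalKernel n (fun k => η k.castSucc) fun k => hη k.castSucc
    have : IsMarkovKernel (η (Fin.last n) : Kernel ((Fin (n + 1) → E) × (Fin n → 𝒮)) 𝒮) :=
      hη (Fin.last n)
    rw [signalKernel]
    exact Kernel.IsMarkovKernel.map _ (measurable_append n)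

/-- The last kernel is Markov, so forgetting its signal leaves the joint kernel of the earlier ones,
which never looks at the last state. -/
lemma map_castSucc_signalKernel {n : ℕ}
    (η : ∀ k : Fin (n + 1), Kernel ((Fin (k.val + 1) → E) × (Fin k.val → 𝒮)) 𝒮)
    (hη : ∀ k, IsMarkovKernel (η k)) (x : Fin (n + 1) → E) :
    (signalKernel (n + 1) η x).map (fun s (j : Fin n) => s j.castSucc) =
      signalKernel n (fun k => η k.castSucc) fun j => x j.castSucc := by
  have := isMarkovKernel_signalKernel n (fun k => η k.castSucc) fun k => hη k.castSucc
  have : IsMarkovKernel (η (Fin.last n) : Kernel ((Fin (n + 1) → E) × (Fin n → 𝒮)) 𝒮) :=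
    hη (Fin.last n)
  rw [signalKernel, Kernel.map_apply _ (measurable_append n),
    Measure.map_map (by fun_prop) (measurable_append n)]
  have h : ((fun s (j : Fin n) => s j.castSucc) ∘
      fun (q : (Fin n → 𝒮) × 𝒮) (j : Fin (n + 1)) =>
        if h : j.val < n then q.1 ⟨j.val, h⟩ else q.2) = Prod.fst := by
    funext q j
    simp
  rw [h, ← Kernel.fst_apply, Kernel.fst_compProd]
  rfl

/-- The signals sent before stage `j` depend only on the states before stage `j`. -/
lemma map_restrict_signalKernel_congr : ∀ {n : ℕ}
    (η : ∀ k : Fin n, Kernel ((Fin (k.val + 1) → E) × (Fin k.val → 𝒮)) 𝒮)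
    (_ : ∀ k, IsMarkovKernel (η k)) (j : ℕ) (x x' : Fin n → E)
    (_ : ∀ i : Fin n, i.val < j → x i = x' i),
    (signalKernel n η x).map (fun s (i : {i : Fin n // i.val < j}) => s i) =
      (signalKernel n η x').map (fun s (i : {i : Fin n // i.val < j}) => s i)
  | 0, _, _, _, x, x', _ => by rw [Subsingleton.elim x x']
  | n + 1, η, hη, j, x, x', h => by
    -- If `j ≤ n`, the last signal is not observed and can be dropped; otherwise the hypothesis
    -- forces all states to agree.
    by_cases hj : j ≤ n
    · have key : ∀ y : Fin (n + 1) → E,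
          (signalKernel (n + 1) η y).map (fun s (i : {i : Fin (n + 1) // i.val < j}) => s i) =
          ((signalKernel n (fun k => η k.castSucc) fun i => y i.castSucc).map
            (fun s (i : {i : Fin n // i.val < j}) => s i)).map
            (fun u (i : {i : Fin (n + 1) // i.val < j}) =>
              u ⟨⟨i.1.val, lt_of_lt_of_le i.2 hj⟩, i.2⟩) := by
        intro y
        rw [← map_castSucc_signalKernel η hη, Measure.map_map (by fun_prop) (by fun_prop),
          Measure.map_map (by fun_prop) (by fun_prop)]
        rfl
      rw [key, key, map_restrict_signalKernel_congr (fun k => η k.castSucc)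
        (fun k => hη k.castSucc) j (fun i => x i.castSucc) (fun i => x' i.castSucc)
        fun i hi => h i.castSucc hi]
    · have : x = x' := funext fun i => h i (by omega)
      rw [this]

/-- A function of the states which is independent of the states in a set of stages is independent
of any signal whose conditional law depends on the states in these stages only. -/
lemma indepFun_compProd {κ : ℕ} {G R : Type*} [Zero E] [MeasurableSpace G] [MeasurableSpace R]
    (μ : Measure (Fin κ → E)) [IsProbabilityMeasure μ]
    (K : Kernel (Fin κ → E) (Fin κ → 𝒮)) [IsMarkovKernel K] (k : Fin κ)
    {r : (Fin κ → 𝒮) → R} (hr : Measurable r)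
    (hK : ∀ x x', (∀ i < k, x i = x' i) → (K x).map r = (K x').map r)
    {f : (Fin κ → E) → G} (hf : Measurable f)
    (hind : IndepFun f (fun x (i : {i : Fin κ // i < k}) => x i) μ) :
    IndepFun (fun z => f z.1) (fun z => r z.2) (μ.compProd K) := by
  rw [indepFun_iff_measure_inter_preimage_eq_mul]
  intro S T hS hT
  -- Extends a past by zeros. By `hK` the filler does not change the law of `r`, so the conditional
  -- probability becomes a measurable function of the past.
  let e : ({i : Fin κ // i < k} → E) → (Fin κ → E) := fun u i => if h : i < k then u ⟨i, h⟩ else 0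
  have he : Measurable e := by
    refine measurable_pi_lambda _ fun i => ?_
    by_cases h : i < k
    · simp only [e, h, dif_pos]; fun_prop
    · simp only [e, h, dif_neg, not_false_eq_true]; fun_prop
  have hg : Measurable fun x => K x (r ⁻¹' T) := Kernel.measurable_coe K (hr hT)
  have hgK : ∀ x, K x (r ⁻¹' T) = K (e fun i => x i) (r ⁻¹' T) := fun x => by
    rw [← Measure.map_apply hr hT, ← Measure.map_apply hr hT]
    refine congrArg (fun m : Measure R => m T) (hK _ _ fun i hi => ?_)
    simp [e, hi]
  have h1 : (fun z : (Fin κ → E) × (Fin κ → 𝒮) => f z.1) ⁻¹' S ∩ (fun z => r z.2) ⁻¹' T =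
      (f ⁻¹' S) ×ˢ (r ⁻¹' T) := rfl
  have h2 : (fun z : (Fin κ → E) × (Fin κ → 𝒮) => f z.1) ⁻¹' S = (f ⁻¹' S) ×ˢ Set.univ := by
    ext; simp
  have h3 : (fun z : (Fin κ → E) × (Fin κ → 𝒮) => r z.2) ⁻¹' T = Set.univ ×ˢ (r ⁻¹' T) := by
    ext; simp
  rw [h1, h2, h3, Measure.compProd_apply_prod (hf hS) (hr hT),
    Measure.compProd_apply_prod (hf hS) MeasurableSet.univ,
    Measure.compProd_apply_prod MeasurableSet.univ (hr hT)]
  simp only [measure_univ, setLIntegral_one, Measure.restrict_univ]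
  -- The indicator depends on `f` and the conditional probability on the past alone, so the integral
  -- of their product factors.
  have hprod := lintegral_mul_eq_lintegral_mul_lintegral_of_indepFun
    (μ := μ) (f := (f ⁻¹' S).indicator 1) (g := fun x => K x (r ⁻¹' T))
    (measurable_one.indicator (hf hS)) hg ?_
  · rw [lintegral_indicator_one (hf hS)] at hprod
    rw [← hprod, ← lintegral_indicator (hf hS)]
    refine lintegral_congr fun x => ?_
    by_cases hx : x ∈ f ⁻¹' S <;> simp [hx]
  · have := hind.comp (φ := S.indicator (1 : G → ENNReal))
      (ψ := fun u => K (e u) (r ⁻¹' T)) (measurable_one.indicator hS) (hg.comp he)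
    have h4 : (fun x => K x (r ⁻¹' T)) = (fun u => K (e u) (r ⁻¹' T)) ∘
        fun x (i : {i : Fin κ // i < k}) => x i := funext hgK
    rw [h4]
    exact this

end Kernels

/-! ### Stage-indexed families and induction over stages. -/

section Stages

variable {κ : ℕ} {M : Type*} [Zero M]

lemma prev_eq_zero (f : Fin κ → M) {k : Fin κ} (hk : k.val = 0) : prev f k = 0 := by
  simp [prev, hk]

lemma prev_eq (f : Fin κ → M) {j k : Fin κ} (h : j.val + 1 = k.val) : prev f k = f j := by
  have : (⟨k.val - 1, by omega⟩ : Fin κ) = j := Fin.ext (by simp; omega)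
  rw [prev, dif_pos (by omega), this]

lemma stage_induction {C : Fin κ → Prop} (zero : ∀ k, k.val = 0 → C k)
    (succ : ∀ j k, j.val + 1 = k.val → C j → C k) (k : Fin κ) : C k := by
  obtain ⟨n, hn⟩ := k
  induction n with
  | zero => exact zero _ rfl
  | succ n ih => exact succ ⟨n, by omega⟩ _ rfl (ih _)

end Stages

/-! ### Linear dependence on a finite set of random vectors. -/

section LinearIn

variable {Ω : Type*} {ι : Type*} {m n l : ℕ}

/-- `y` is a linear function of the vectors `s j`, `j ∈ I`. -/
def IsLinearIn (I : Finset ι) (s : ι → Ω → EuclideanSpace ℝ (Fin m))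
    (y : Ω → EuclideanSpace ℝ (Fin n)) : Prop :=
  ∃ T : (I → EuclideanSpace ℝ (Fin m)) →L[ℝ] EuclideanSpace ℝ (Fin n),
    ∀ ω, y ω = T fun j => s j ω

namespace IsLinearIn

variable {I J : Finset ι} {s : ι → Ω → EuclideanSpace ℝ (Fin m)}
  {y z : Ω → EuclideanSpace ℝ (Fin n)}

lemma zero : IsLinearIn I s (0 : Ω → EuclideanSpace ℝ (Fin n)) := ⟨0, fun ω => by simp⟩

lemma self {j : ι} (hj : j ∈ I) : IsLinearIn I s (s j) :=
  ⟨ContinuousLinearMap.proj ⟨j, hj⟩, fun _ => rfl⟩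

lemma add (hy : IsLinearIn I s y) (hz : IsLinearIn I s z) :
    IsLinearIn I s fun ω => y ω + z ω := by
  obtain ⟨T, hT⟩ := hy
  obtain ⟨U, hU⟩ := hz
  exact ⟨T + U, fun ω => by simp [hT, hU]⟩

lemma sub (hy : IsLinearIn I s y) (hz : IsLinearIn I s z) :
    IsLinearIn I s fun ω => y ω - z ω := by
  obtain ⟨T, hT⟩ := hy
  obtain ⟨U, hU⟩ := hz
  exact ⟨T - U, fun ω => by simp [hT, hU]⟩

lemma lin (M : Matrix (Fin l) (Fin n) ℝ) (hy : IsLinearIn I s y) :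
    IsLinearIn I s fun ω => M.toEuclideanLin (y ω) := by
  obtain ⟨T, hT⟩ := hy
  exact ⟨(LinearMap.toContinuousLinearMap M.toEuclideanLin).comp T, fun ω => by simp [hT]⟩

lemma mono (h : I ⊆ J) (hy : IsLinearIn I s y) : IsLinearIn J s y := by
  obtain ⟨T, hT⟩ := hy
  refine ⟨T.comp (ContinuousLinearMap.pi fun i : I => ContinuousLinearMap.proj ⟨i.1, h i.2⟩),
    fun ω => ?_⟩
  rw [hT]
  rfl

end IsLinearIn

end LinearIn

/-! ### Structure of the Gauss–Markov process. -/

section GaussMarkov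

variable {Ω : Type*} [MeasurableSpace Ω] {P : Measure Ω} {m κ : ℕ}
  {A S₁ Sw : Matrix (Fin m) (Fin m) ℝ} {x : Fin κ → Ω → EuclideanSpace ℝ (Fin m)}

omit [MeasurableSpace Ω] in
lemma eq_add_innovation (A : Matrix (Fin m) (Fin m) ℝ) (x : Fin κ → Ω → EuclideanSpace ℝ (Fin m))
    (k : Fin κ) (ω : Ω) : x k ω = A.toEuclideanLin (prev x k ω) + innovation A x k ω := by
  simp [innovation]

omit [MeasurableSpace Ω] in
-- Unrolling the recursion expresses a state through the innovations up to its own stage. Both the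
-- independence of an innovation from the past and joint Gaussianity come from this.
lemma isLinearIn_innovation (A : Matrix (Fin m) (Fin m) ℝ)
    (x : Fin κ → Ω → EuclideanSpace ℝ (Fin m)) (k : Fin κ) :
    IsLinearIn (Finset.Iic k) (innovation A x) (x k) := by
  induction k using stage_induction with
  | zero k hk =>
    have : x k = fun ω => innovation A x k ω := funext fun ω => by
      rw [innovation, prev_eq_zero x hk]; simp
    rw [this]
    exact .self (Finset.mem_Iic.2 le_rfl)
  | succ j k h ih =>
    have : x k = fun ω => A.toEuclideanLin (x j ω) + innovation A x k ω := funext fun ω => by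
      rw [innovation, prev_eq x h]; simp
    rw [this]
    refine .add (.lin A (ih.mono ?_)) (.self (Finset.mem_Iic.2 le_rfl))
    exact Finset.Iic_subset_Iic.2 (Fin.le_def.2 (by omega))

omit [MeasurableSpace Ω] in
-- The innovation is one fixed function of the trajectory, so its properties depend only on the law
-- of the states.
lemma innovation_eq_comp (A : Matrix (Fin m) (Fin m) ℝ)
    (x : Fin κ → Ω → EuclideanSpace ℝ (Fin m)) (k : Fin κ) :
    innovation A x k = innovation A (fun k (z : Fin κ → EuclideanSpace ℝ (Fin m)) => z k) k ∘
      fun ω k => x k ω := by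
  funext ω
  simp only [innovation, prev, Function.comp]
  split_ifs <;> rfl

namespace IsGaussMarkov

lemma isProbabilityMeasure (hx : IsGaussMarkov P A S₁ Sw x) : IsProbabilityMeasure P :=
  hx.indep.isProbabilityMeasure

lemma measurable_innovation (hx : IsGaussMarkov P A S₁ Sw x) (k : Fin κ) :
    Measurable (innovation A x k) :=
  _root_.measurable_innovation A hx.measurable k

/-- The innovation is independent of the earlier states. -/
lemma indepFun_innovation (hx : IsGaussMarkov P A S₁ Sw x) (k : Fin κ) :
    IndepFun (innovation A x k) (fun ω (j : {j : Fin κ // j < k}) => x j ω) P := by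
  have h := hx.indep.indepFun_finset {k} (Finset.Iio k) (by simp) hx.measurable_innovation
  choose T hT using fun j : {j : Fin κ // j < k} => (isLinearIn_innovation A x j.1).mono
    (J := Finset.Iio k) fun i hi => Finset.mem_Iio.2 ((Finset.mem_Iic.1 hi).trans_lt j.2)
  have h' := h.comp (measurable_pi_apply ⟨k, Finset.mem_singleton_self k⟩)
    (measurable_pi_lambda (fun u (j : {j : Fin κ // j < k}) => T j u)
      fun j => (T j).continuous.measurable)
  have e : (fun ω (j : {j : Fin κ // j < k}) => x j ω) =
      (fun u (j : {j : Fin κ // j < k}) => T j u) ∘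
        fun ω (i : Finset.Iio k) => innovation A x i ω := by
    funext ω j
    exact hT j ω
  rw [e]
  exact h'

/-- Being a Gauss–Markov process is a property of the law. -/
lemma of_map_eq {Ω' : Type*} [MeasurableSpace Ω'] {P' : Measure Ω'}
    {x' : Fin κ → Ω' → EuclideanSpace ℝ (Fin m)} (hx : IsGaussMarkov P A S₁ Sw x)
    (hx' : ∀ k, Measurable (x' k))
    (h : P'.map (fun ω k => x' k ω) = P.map fun ω k => x k ω) :
    IsGaussMarkov P' A S₁ Sw x' := by
  have hP := hx.indep.isProbabilityMeasure
  have hX : Measurable fun ω k => x k ω := measurable_pi_lambda _ hx.measurable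
  have hX' : Measurable fun ω k => x' k ω := measurable_pi_lambda _ hx'
  have hP' : IsProbabilityMeasure P' := by
    have : IsProbabilityMeasure (P'.map fun ω k => x' k ω) :=
      h ▸ Measure.isProbabilityMeasure_map hX.aemeasurable
    exact Measure.isProbabilityMeasure_of_map (fun ω k => x' k ω)
  let φ : Fin κ → (Fin κ → EuclideanSpace ℝ (Fin m)) → EuclideanSpace ℝ (Fin m) :=
    innovation A fun k z => z k
  have hφ : ∀ k, Measurable (φ k) := _root_.measurable_innovation A fun k => measurable_pi_apply k
  have hφ' : Measurable fun z k => φ k z := measurable_pi_lambda _ hφ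
  have e : (fun ω k => innovation A x k ω) = (fun z k => φ k z) ∘ fun ω k => x k ω :=
    funext fun ω => funext fun k => congrFun (innovation_eq_comp A x k) ω
  have e' : (fun ω k => innovation A x' k ω) = (fun z k => φ k z) ∘ fun ω k => x' k ω :=
    funext fun ω => funext fun k => congrFun (innovation_eq_comp A x' k) ω
  have hk : ∀ k, P'.map (innovation A x' k) = P.map (innovation A x k) := fun k => by
    rw [innovation_eq_comp A x', innovation_eq_comp A x, ← Measure.map_map (hφ k) hX', ← Measure.map_map (hφ k) hX, h]
  refine ⟨hx', hx.posSemidef_init, hx.posSemidef_noise, fun k h0 => (hk k).trans (hx.law_init k h0),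
    fun k h0 => (hk k).trans (hx.law_noise k h0), ?_⟩
  rw [iIndepFun_iff_map_fun_eq_pi_map
    fun k => (_root_.measurable_innovation A hx' k).aemeasurable]
  simp_rw [hk]
  rw [← (iIndepFun_iff_map_fun_eq_pi_map fun k => (hx.measurable_innovation k).aemeasurable).1
    hx.indep, e', e, ← Measure.map_map hφ' hX', ← Measure.map_map hφ' hX, h]

lemma hasGaussianLaw_innovation (hx : IsGaussMarkov P A S₁ Sw x) (k : Fin κ) :
    HasGaussianLaw (innovation A x k) P := by
  by_cases h : k.val = 0
  · exact ⟨by rw [hx.law_init k h]; infer_instance⟩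
  · exact ⟨by rw [hx.law_noise k h]; infer_instance⟩

/-- The trajectory is a linear image of independent Gaussian innovations, which are jointly
Gaussian. -/
lemma hasGaussianLaw (hx : IsGaussMarkov P A S₁ Sw x) :
    HasGaussianLaw (fun ω k => x k ω) P := by
  have h := hx.indep.hasGaussianLaw hx.hasGaussianLaw_innovation
  choose T hT using fun k : Fin κ => (isLinearIn_innovation A x k).mono (Finset.subset_univ _)
  have h' := h.map (ContinuousLinearMap.pi fun k => (T k).comp
    (ContinuousLinearMap.pi fun i : (Finset.univ : Finset (Fin κ)) =>
      ContinuousLinearMap.proj (i : Fin κ)))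
  convert! h' using 1
  funext ω k
  exact hT k ω

lemma memLp (hx : IsGaussMarkov P A S₁ Sw x) (k : Fin κ) : MemLp (x k) 2 P :=
  (hx.hasGaussianLaw.eval k).memLp_two

lemma integral_eq_zero (hx : IsGaussMarkov P A S₁ Sw x) (k : Fin κ) : ∫ ω, x k ω ∂P = 0 := by
  have hi : ∀ k, ∫ ω, innovation A x k ω ∂P = 0 := fun k => by
    rw [← integral_map (φ := innovation A x k) (f := fun v => v)
      (hx.measurable_innovation k).aemeasurable (by fun_prop)]
    by_cases h : k.val = 0
    · rw [hx.law_init k h]; simp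
    · rw [hx.law_noise k h]; simp
  induction k using stage_induction with
  | zero k hk =>
    have : ∀ ω, x k ω = innovation A x k ω := fun ω => by
      rw [innovation, prev_eq_zero x hk]; simp
    simp_rw [this, hi]
  | succ j k h ih =>
    have : ∀ ω, x k ω = A.toEuclideanLin (x j ω) + innovation A x k ω := fun ω => by
      rw [innovation, prev_eq x h]; simp
    have := hx.isProbabilityMeasure
    have hl := (LinearMap.toContinuousLinearMap A.toEuclideanLin).integral_comp_comm
        ((hx.memLp j).integrable (by norm_num))
    rw [ih, map_zero] at hl
    simp_rw [‹∀ ω, x k ω = _›]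
    rw [integral_add ((((hx.memLp j).toEuclideanLin A).integrable (by norm_num)))
      (hx.hasGaussianLaw_innovation k).integrable, hi, add_zero]
    exact hl

end IsGaussMarkov

end GaussMarkov

/-! ### The joint law of states and signals, and its form under linear policies. -/

section JointLaw

variable {Ω 𝒮 : Type*} [MeasurableSpace Ω] [MeasurableSpace 𝒮] {P : Measure Ω} {m κ : ℕ}
  {A S₁ Sw : Matrix (Fin m) (Fin m) ℝ} {x : Fin κ → Ω → EuclideanSpace ℝ (Fin m)}

namespace SignalingPolicy

variable (η : SignalingPolicy m κ 𝒮)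

instance isMarkovKernel_signalKernel_kernel : IsMarkovKernel (signalKernel κ η.kernel) :=
  isMarkovKernel_signalKernel κ _ η.isMarkovKernel

lemma isProbabilityMeasure_jointLaw [IsProbabilityMeasure P] (hx : ∀ k, Measurable (x k)) :
    IsProbabilityMeasure (η.jointLaw P x) := by
  have : IsProbabilityMeasure (P.map fun ω k => x k ω) :=
    Measure.isProbabilityMeasure_map (measurable_pi_lambda _ hx).aemeasurable
  rw [jointLaw]
  infer_instance

lemma map_fst_jointLaw [IsProbabilityMeasure P] (hx : ∀ k, Measurable (x k)) :
    (η.jointLaw P x).map (fun z k => z.1 k) = P.map fun ω k => x k ω := by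
  have : IsProbabilityMeasure (P.map fun ω k => x k ω) :=
    Measure.isProbabilityMeasure_map (measurable_pi_lambda _ hx).aemeasurable
  exact Measure.fst_compProd _ _

/-- Adding signals does not change the marginal law of the states, and the property depends on that
law only. -/
lemma isGaussMarkov_jointLaw (hx : IsGaussMarkov P A S₁ Sw x) :
    IsGaussMarkov (η.jointLaw P x) A S₁ Sw fun k z => z.1 k := by
  have := hx.isProbabilityMeasure
  exact hx.of_map_eq (fun k => by fun_prop) (η.map_fst_jointLaw hx.measurable)

lemma covMat_jointLaw [IsProbabilityMeasure P] (hx : ∀ k, Measurable (x k)) (k : Fin κ) :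
    covMat (η.jointLaw P x) (fun z => z.1 k) = covMat P (x k) := by
  have h : Measurable fun z : Fin κ → EuclideanSpace ℝ (Fin m) => z k := measurable_pi_apply k
  have h1 := crossCov_map (Q := η.jointLaw P x)
    (T := fun z k => z.1 k) (y := fun z => z k) (by fun_prop) h h
  have h2 := crossCov_map (Q := P) (T := fun ω k => x k ω) (y := fun z => z k)
    (measurable_pi_lambda _ hx) h h
  rw [η.map_fst_jointLaw hx, h2] at h1
  exact h1.symm

/-- The covariances of the posterior estimates under a policy satisfy the necessary condition. -/
theorem estimateCov_mem_feasible (hx : IsGaussMarkov P A S₁ Sw x) :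
    η.estimateCov P x ∈ feasible A fun k => covMat P (x k) := by
  have hP := hx.isProbabilityMeasure
  have hJ := η.isProbabilityMeasure_jointLaw (P := P) hx.measurable
  have hJx := η.isGaussMarkov_jointLaw hx
  have hX : Measurable fun ω k => x k ω := measurable_pi_lambda _ hx.measurable
  have : IsProbabilityMeasure (P.map fun ω k => x k ω) :=
    Measure.isProbabilityMeasure_map hX.aemeasurable
  -- The coordinate process on trajectory space, where `indepFun_compProd` needs the independence.
  have hc : IsGaussMarkov (P.map fun ω k => x k ω) A S₁ Sw fun k z => z k :=
    hx.of_map_eq (fun k => measurable_pi_apply k) Measure.map_id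
  have h := posteriorCov_mem_feasible (P := η.jointLaw P x) A (x := fun k z => z.1 k)
    (s := fun k z => z.2 k) hJx.measurable hJx.memLp (fun k => by fun_prop) fun k => by
      have h := indepFun_compProd (P.map fun ω k => x k ω) (signalKernel κ η.kernel) k
        (r := fun s (j : {j : Fin κ // j < k}) => s j) (by fun_prop)
        (fun z z' hz => map_restrict_signalKernel_congr η.kernel η.isMarkovKernel k.val z z'
          fun i hi => hz i hi) (hc.measurable_innovation k) (hc.indepFun_innovation k)
      rw [innovation_eq_comp]
      exact h
  simp_rw [η.covMat_jointLaw hx.measurable] at h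
  exact h

end SignalingPolicy

lemma linearPolicy_kernel_apply (L N : Fin κ → Matrix (Fin m) (Fin m) ℝ) (k : Fin κ)
    (q : (Fin (k.val + 1) → EuclideanSpace ℝ (Fin m)) × (Fin k.val → EuclideanSpace ℝ (Fin m))) :
    (linearPolicy L N).kernel k q = (multivariateGaussian 0 (N k)).map fun v =>
      (L k)ᵀ.toEuclideanLin (q.1 (Fin.last k.val)) + v := by
  have h := measurable_toEuclideanLin (L k)ᵀ
  simp only [linearPolicy]
  rw [Kernel.map_apply _ (by fun_prop), Kernel.prod_apply, Kernel.id_apply, Kernel.const_apply,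
    Measure.dirac_prod, Measure.map_map (by fun_prop) (by fun_prop)]
  rfl

/-- The kernels ignore earlier signals, so given the states the signals are independent shifted
Gaussians. -/
lemma signalKernel_linearPolicy : ∀ {n : ℕ} (L N : Fin n → Matrix (Fin m) (Fin m) ℝ)
    (x : Fin n → EuclideanSpace ℝ (Fin m)),
    signalKernel n (linearPolicy L N).kernel x = Measure.pi fun k =>
      (multivariateGaussian 0 (N k)).map fun v => (L k)ᵀ.toEuclideanLin (x k) + v
  | 0, L, N, x => by
    rw [signalKernel, Kernel.const_apply, Measure.pi_of_empty]
    congr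
  | n + 1, L, N, x => by
    have hp : ∀ k, IsProbabilityMeasure ((multivariateGaussian 0 (N k)).map fun v =>
        (L k)ᵀ.toEuclideanLin (x k) + v) := fun k =>
      Measure.isProbabilityMeasure_map (by fun_prop)
    have hm := isMarkovKernel_signalKernel n (fun k => (linearPolicy L N).kernel k.castSucc)
      fun k => (linearPolicy L N).isMarkovKernel k.castSucc
    have : IsMarkovKernel ((linearPolicy L N).kernel (Fin.last n) :
        Kernel ((Fin (n + 1) → EuclideanSpace ℝ (Fin m)) × (Fin n → EuclideanSpace ℝ (Fin m)))
          (EuclideanSpace ℝ (Fin m))) :=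
      (linearPolicy L N).isMarkovKernel (Fin.last n)
    have ih := signalKernel_linearPolicy (fun k => L k.castSucc) (fun k => N k.castSucc)
      fun k => x k.castSucc
    refine (Measure.pi_eq fun t ht => ?_).symm
    rw [signalKernel, Kernel.map_apply' _ (measurable_append n) _ (MeasurableSet.univ_pi ht),
      Kernel.compProd_apply (measurable_append n (MeasurableSet.univ_pi ht)), Kernel.comap_apply]
    -- The right-hand side is free of `b`, so on boxes the integral over the earlier signals
    -- factors.
    have hlast : ∀ b : Fin n → EuclideanSpace ℝ (Fin m),
        ((linearPolicy L N).kernel (Fin.last n) : Kernel ((Fin (n + 1) → EuclideanSpace ℝ (Fin m)) ×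
          (Fin n → EuclideanSpace ℝ (Fin m))) (EuclideanSpace ℝ (Fin m))) (x, b) =
        (multivariateGaussian 0 (N (Fin.last n))).map fun v =>
          (L (Fin.last n))ᵀ.toEuclideanLin (x (Fin.last n)) + v := fun b =>
      linearPolicy_kernel_apply L N (Fin.last n) (x, b)
    have hset : ∀ b : Fin n → EuclideanSpace ℝ (Fin m),
        Prod.mk b ⁻¹' ((fun (q : (Fin n → EuclideanSpace ℝ (Fin m)) × EuclideanSpace ℝ (Fin m))
          (j : Fin (n + 1)) => if h : j.val < n then q.1 ⟨j.val, h⟩ else q.2) ⁻¹' Set.univ.pi t) =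
        {c | b ∈ Set.univ.pi (fun i : Fin n => t i.castSucc) ∧ c ∈ t (Fin.last n)} := by
      intro b
      ext c
      simp [Set.mem_pi, Fin.forall_fin_succ']
    simp_rw [hlast, hset]
    rw [Fin.prod_univ_castSucc]
    set ν := (multivariateGaussian 0 (N (Fin.last n))).map fun v =>
          (L (Fin.last n))ᵀ.toEuclideanLin (x (Fin.last n)) + v
    have hind : ∀ b : Fin n → EuclideanSpace ℝ (Fin m),
        ν {c | b ∈ Set.univ.pi (fun i : Fin n => t i.castSucc) ∧ c ∈ t (Fin.last n)} =
        (Set.univ.pi fun i : Fin n => t i.castSucc).indicator (fun _ => ν (t (Fin.last n))) b := by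
      intro b
      by_cases hb : b ∈ Set.univ.pi fun i : Fin n => t i.castSucc
      · rw [Set.indicator_of_mem hb]; simp only [hb, true_and]; rfl
      · rw [Set.indicator_of_notMem hb]; simp only [hb, false_and]; simp
    simp_rw [hind]
    rw [lintegral_indicator_const (MeasurableSet.univ_pi fun i => ht _), mul_comm]
    congr 1
    rw [← Measure.pi_pi, ← ih]
    rfl

/-- Under a linear policy the vectors `s_k - L_k' x_k` are independent Gaussian vectors which are
independent of the states. -/
lemma map_noise_jointLaw_linearPolicy [IsProbabilityMeasure P] (hx : ∀ k, Measurable (x k))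
    (L N : Fin κ → Matrix (Fin m) (Fin m) ℝ) :
    ((linearPolicy L N).jointLaw P x).map
      (fun z => (z.1, fun k => z.2 k - (L k)ᵀ.toEuclideanLin (z.1 k))) =
    (P.map fun ω k => x k ω).prod (Measure.pi fun k => multivariateGaussian 0 (N k)) := by
  have : IsProbabilityMeasure (P.map fun ω k => x k ω) :=
    Measure.isProbabilityMeasure_map (measurable_pi_lambda _ hx).aemeasurable
  have hL : ∀ k, Measurable fun v : EuclideanSpace ℝ (Fin m) => (L k)ᵀ.toEuclideanLin v :=
    fun k => measurable_toEuclideanLin _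
  have hW : Measurable fun z : (Fin κ → EuclideanSpace ℝ (Fin m)) ×
      (Fin κ → EuclideanSpace ℝ (Fin m)) =>
      (z.1, fun k => z.2 k - (L k)ᵀ.toEuclideanLin (z.1 k)) := by
    refine measurable_fst.prodMk (measurable_pi_lambda _ fun k => ?_)
    have := hL k
    fun_prop
  refine (Measure.prod_eq fun S T hS hT => ?_).symm
  rw [Measure.map_apply hW (hS.prod hT), SignalingPolicy.jointLaw,
    Measure.compProd_apply (hW (hS.prod hT)), mul_comm, ← lintegral_indicator_const hS]
  refine lintegral_congr fun y => ?_
  -- For fixed states the signals are the noises shifted by a constant; subtracting the shift leaves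
  -- a law that no longer depends on `y`.
  have hpi : signalKernel κ (linearPolicy L N).kernel y =
      (Measure.pi fun k => multivariateGaussian 0 (N k)).map
        fun v k => (L k)ᵀ.toEuclideanLin (y k) + v k := by
    rw [signalKernel_linearPolicy, Measure.pi_map_pi]
    intro k
    fun_prop
  rw [hpi, Measure.map_apply (measurable_pi_lambda _ fun k => by fun_prop)
    (measurable_prodMk_left (hW (hS.prod hT)))]
  by_cases hy : y ∈ S
  · rw [Set.indicator_of_mem hy]
    congr 1
    ext v
    simp [hy]
  · rw [Set.indicator_of_notMem hy]
    convert measure_empty (μ := Measure.pi fun k => multivariateGaussian 0 (N k))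
    ext v
    simp [hy]

end JointLaw

/-! ### Uncorrelatedness passes to linear combinations. -/

namespace IsLinearIn

variable {Ω ι : Type*} [MeasurableSpace Ω] {P : Measure Ω} {m n l : ℕ} {I : Finset ι}
  {s : ι → Ω → EuclideanSpace ℝ (Fin m)} {y : Ω → EuclideanSpace ℝ (Fin n)}
  {z : Ω → EuclideanSpace ℝ (Fin l)}

lemma memLp (hy : IsLinearIn I s y) (hs : ∀ j, MemLp (s j) 2 P) : MemLp y 2 P := by
  obtain ⟨T, hT⟩ := hy
  rw [show y = _ from funext hT]
  exact T.comp_memLp' (MemLp.of_eval fun j => hs j)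

lemma strongDual_pi_apply [DecidableEq ι]
    (g : StrongDual ℝ (I → EuclideanSpace ℝ (Fin m))) (v : I → EuclideanSpace ℝ (Fin m)) :
    g v = ∑ j, g.comp (ContinuousLinearMap.single ℝ _ j) (v j) := by
  conv_lhs => rw [← Finset.univ_sum_single v]
  simp [map_sum]

variable [IsProbabilityMeasure P]

lemma covariance_strongDual_eq_zero (hz : MemLp z 2 P) (hs : ∀ j, MemLp (s j) 2 P)
    (h : ∀ j ∈ I, crossCov P z (s j) = 0) (f : StrongDual ℝ (EuclideanSpace ℝ (Fin l)))
    (g : StrongDual ℝ (I → EuclideanSpace ℝ (Fin m))) :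
    cov[fun ω => f (z ω), fun ω => g fun j => s j ω; P] = 0 := by
  classical
  rw [show (fun ω => g fun j : I => s j ω) = _ from
    funext fun ω => strongDual_pi_apply g fun j => s j ω]
  refine (covariance_fun_sum_right
    (fun j : I => (g.comp (ContinuousLinearMap.single ℝ _ j)).comp_memLp' (hs j))
    (f.comp_memLp' hz)).trans ?_
  exact Finset.sum_eq_zero fun j _ => covariance_dual_eq_zero (h j j.2) hz (hs j) _ _

lemma crossCov_eq_zero (hy : IsLinearIn I s y) (hz : MemLp z 2 P) (hs : ∀ j, MemLp (s j) 2 P)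
    (h : ∀ j ∈ I, crossCov P z (s j) = 0) : crossCov P z y = 0 := by
  obtain ⟨T, hT⟩ := hy
  ext i j
  simp only [crossCov, Matrix.of_apply, hT]
  exact covariance_strongDual_eq_zero hz hs h (EuclideanSpace.proj i)
    ((EuclideanSpace.proj (𝕜 := ℝ) j).comp T)

end IsLinearIn

/-! ### The Kalman recursion and posteriors under linear rules. -/

section LinearRules

variable {Ω : Type*} [MeasurableSpace Ω] {P : Measure Ω} {m κ : ℕ}
  {A S₁ Sw : Matrix (Fin m) (Fin m) ℝ} {x : Fin κ → Ω → EuclideanSpace ℝ (Fin m)}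
  {L N M H : Fin κ → Matrix (Fin m) (Fin m) ℝ} {n : Fin κ → Ω → EuclideanSpace ℝ (Fin m)}

lemma covMat_of_map_eq {N : Matrix (Fin m) (Fin m) ℝ} (hN : N.PosSemidef)
    {y : Ω → EuclideanSpace ℝ (Fin m)} (hy : Measurable y)
    (h : P.map y = multivariateGaussian 0 N) : covMat P y = N := by
  have h1 := crossCov_map (Q := P) (T := y) (y := fun v => v) (z := fun v => v) hy
    measurable_id measurable_id
  rw [h] at h1
  rw [covMat_eq_crossCov, ← h1]
  ext i j
  exact covariance_eval_multivariateGaussian hN i j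

/-- One step of the linear estimation recursion. The matrices `L`, `N` are the gain and the noise
covariance of the rule, and `M` is the gain of the estimator. -/
lemma exists_estimate_step [IsProbabilityMeasure P] {s : Fin κ → Ω → EuclideanSpace ℝ (Fin m)}
    {L N M B : Matrix (Fin m) (Fin m) ℝ} {k : Fin κ}
    {u xh w v : Ω → EuclideanSpace ℝ (Fin m)} (hs : ∀ j, MemLp (s j) 2 P) (hu : MemLp u 2 P)
    (hw : MemLp w 2 P) (hv : MemLp v 2 P)
    (hsk : ∀ ω, s k ω = Lᵀ.toEuclideanLin (A.toEuclideanLin (u ω) + w ω) + v ω)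
    (hws : ∀ j < k, crossCov P w (s j) = 0) (hvs : ∀ j < k, crossCov P v (s j) = 0)
    (hvx : crossCov P (fun ω => A.toEuclideanLin (u ω) + w ω) v = 0)
    (hxh : IsLinearIn (Finset.Iio k) s xh)
    (hus : ∀ j < k, crossCov P (fun ω => u ω - xh ω) (s j) = 0) (hB : covMat P xh = B)
    (hvN : covMat P v = N)
    (hR : (covMat P (fun ω => A.toEuclideanLin (u ω) + w ω) - A * B * Aᵀ) * L =
      M * (Lᵀ * (covMat P (fun ω => A.toEuclideanLin (u ω) + w ω) - A * B * Aᵀ) * L + N)) :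
    ∃ y, IsLinearIn (Finset.Iic k) s y ∧
      (∀ j ≤ k, crossCov P (fun ω => (A.toEuclideanLin (u ω) + w ω) - y ω) (s j) = 0) ∧
      covMat P y = A * B * Aᵀ +
        (covMat P (fun ω => A.toEuclideanLin (u ω) + w ω) - A * B * Aᵀ) * L * Mᵀ := by
  have hxhL : MemLp xh 2 P := hxh.memLp hs
  have hAxh := hxhL.toEuclideanLin A
  have hAu := hu.toEuclideanLin A
  have hx : MemLp (fun ω => A.toEuclideanLin (u ω) + w ω) 2 P := hAu.add hw
  set x : Ω → EuclideanSpace ℝ (Fin m) := fun ω => A.toEuclideanLin (u ω) + w ω with hxdef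
  -- The prediction error: uncorrelated with the earlier signals and with the current noise.
  let r : Ω → EuclideanSpace ℝ (Fin m) := fun ω => x ω - A.toEuclideanLin (xh ω)
  have hr : MemLp r 2 P := hx.sub hAxh
  have hrs : ∀ j < k, crossCov P r (s j) = 0 := fun j hj => by
    have e : r = fun ω => A.toEuclideanLin (u ω - xh ω) + w ω := funext fun ω => by
      simp only [r, hxdef, map_sub]; abel
    have huxh : MemLp (fun ω => u ω - xh ω) 2 P := hu.sub hxhL
    rw [e, crossCov_add_left (huxh.toEuclideanLin A) hw (hs j), crossCov_lin_left A huxh (hs j),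
      hus j hj, hws j hj]
    simp
  have hmem : ∀ j ∈ Finset.Iio k, j < k := fun j hj => Finset.mem_Iio.1 hj
  have hrxh : crossCov P r xh = 0 := hxh.crossCov_eq_zero hr hs fun j hj => hrs j (hmem j hj)
  have hvxh : crossCov P v xh = 0 := hxh.crossCov_eq_zero hv hs fun j hj => hvs j (hmem j hj)
  have hxhv : crossCov P xh v = 0 := by rw [← crossCov_transpose, hvxh, Matrix.transpose_zero]
  have hxhr : crossCov P xh r = 0 := by rw [← crossCov_transpose, hrxh, Matrix.transpose_zero]
  have hrv : crossCov P r v = 0 := by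
    rw [crossCov_sub_left hx hAxh hv, hvx, crossCov_lin_left A hxhL hv, hxhv]
    simp
  have hvr : crossCov P v r = 0 := by rw [← crossCov_transpose, hrv, Matrix.transpose_zero]
  -- Pythagoras: the state is the prediction plus the uncorrelated error `r`.
  have hcr : crossCov P r r = covMat P x - A * B * Aᵀ := by
    have e : x = fun ω => A.toEuclideanLin (xh ω) + r ω := funext fun ω => by simp [r]
    have h : covMat P x = A * B * Aᵀ + crossCov P r r := by
      conv_lhs => rw [e]
      have hsum : MemLp (fun ω => A.toEuclideanLin (xh ω) + r ω) 2 P := hAxh.add hr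
      rw [covMat_eq_crossCov, crossCov_add_left hAxh hr hsum, crossCov_add_right hAxh hAxh hr,
        crossCov_add_right hr hAxh hr, ← covMat_eq_crossCov, covMat_lin A hxhL, hB,
        crossCov_lin_left A hxhL hr, hxhr, crossCov_lin_right A hr hxhL, hrxh]
      simp
    rw [h, add_sub_cancel_left]
  rw [← hcr] at hR ⊢
  set R := crossCov P r r with hRdef
  -- The part of the current signal that the earlier signals do not predict linearly.
  let z : Ω → EuclideanSpace ℝ (Fin m) := fun ω => Lᵀ.toEuclideanLin (r ω) + v ω
  have hLr := hr.toEuclideanLin Lᵀ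
  have hz : MemLp z 2 P := hLr.add hv
  have hsz : ∀ ω, s k ω = Lᵀ.toEuclideanLin (A.toEuclideanLin (xh ω)) + z ω := fun ω => by
    have e : A.toEuclideanLin (u ω) + w ω = A.toEuclideanLin (xh ω) + r ω := by simp [r, hxdef]
    rw [hsk, e, map_add]
    simp only [z]
    abel
  have hzs : ∀ j < k, crossCov P z (s j) = 0 := fun j hj => by
    rw [crossCov_add_left hLr hv (hs j), crossCov_lin_left _ hr (hs j), hrs j hj, hvs j hj]
    simp
  have hzxh : crossCov P z xh = 0 := hxh.crossCov_eq_zero hz hs fun j hj => hzs j (hmem j hj)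
  have hxhz : crossCov P xh z = 0 := by rw [← crossCov_transpose, hzxh, Matrix.transpose_zero]
  have hrz : crossCov P r z = R * L := by
    rw [crossCov_add_right hr hLr hv, crossCov_lin_right _ hr hr, hrv, add_zero,
      Matrix.transpose_transpose]
  have hzz : crossCov P z z = Lᵀ * R * L + N := by
    rw [crossCov_add_left hLr hv hz, crossCov_lin_left _ hr hz, hrz, crossCov_add_right hv hLr hv,
      crossCov_lin_right _ hv hr, hvr, ← covMat_eq_crossCov v, hvN]
    simp [Matrix.mul_assoc]
  have hMz := hz.toEuclideanLin M
  have hy : MemLp (fun ω => A.toEuclideanLin (xh ω) + M.toEuclideanLin (z ω)) 2 P := hAxh.add hMz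
  -- The Kalman update: prediction plus `M` times the new information.
  refine ⟨fun ω => A.toEuclideanLin (xh ω) + M.toEuclideanLin (z ω), ?_, ?_, ?_⟩
  · have hxh' := hxh.mono (J := Finset.Iic k) Finset.Iio_subset_Iic_self
    have e : z = fun ω => s k ω - Lᵀ.toEuclideanLin (A.toEuclideanLin (xh ω)) :=
      funext fun ω => by rw [hsz]; simp
    refine (hxh'.lin A).add (IsLinearIn.lin M ?_)
    rw [e]
    exact (IsLinearIn.self (Finset.mem_Iic.2 le_rfl)).sub ((hxh'.lin A).lin Lᵀ)
  · intro j hj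
    have e : (fun ω => x ω - (A.toEuclideanLin (xh ω) + M.toEuclideanLin (z ω))) =
        fun ω => r ω - M.toEuclideanLin (z ω) := funext fun ω => by simp only [r]; abel
    rw [e, crossCov_sub_left hr hMz (hs j), crossCov_lin_left M hz (hs j)]
    rcases hj.lt_or_eq with hj | rfl
    · rw [hrs j hj, hzs j hj]
      simp
    -- For the current signal, orthogonality of the error is the normal equation `hR`.
    · rw [show s j = _ from funext hsz, crossCov_add_right hr (hAxh.toEuclideanLin _) hz,
        crossCov_add_right hz (hAxh.toEuclideanLin _) hz, crossCov_lin_right _ hr hAxh,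
        crossCov_lin_right _ hr hxhL, crossCov_lin_right _ hz hAxh, crossCov_lin_right _ hz hxhL,
        hrxh, hzxh, hrz, hzz, hR]
      simp
  · rw [covMat_eq_crossCov, crossCov_add_left hAxh hMz hy, crossCov_add_right hAxh hAxh hMz,
      crossCov_add_right hMz hAxh hMz, ← covMat_eq_crossCov, covMat_lin A hxhL, hB,
      crossCov_lin_left A hxhL hMz, crossCov_lin_right M hxhL hz, hxhz,
      crossCov_lin_left M hz hAxh, crossCov_lin_right A hz hxhL, hzxh, ← covMat_eq_crossCov,
      covMat_lin M hz, covMat_eq_crossCov z, hzz, ← hR]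
    simp

/-- Runs the update along the stages. The invariant is an estimate linear in the signals so far,
with error uncorrelated with each of them and with covariance `H k`. -/
lemma exists_linear_estimate (hx : IsGaussMarkov P A S₁ Sw x) (hN : ∀ k, (N k).PosSemidef)
    (hR : ∀ k, (covMat P (x k) - A * prev H k * Aᵀ) * L k =
      M k * ((L k)ᵀ * (covMat P (x k) - A * prev H k * Aᵀ) * L k + N k))
    (hM : ∀ k, (covMat P (x k) - A * prev H k * Aᵀ) * L k * (M k)ᵀ = H k - A * prev H k * Aᵀ)
    (hn : ∀ k, Measurable (n k)) (hnN : ∀ k, P.map (n k) = multivariateGaussian 0 (N k))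
    (hni : iIndepFun n P) (hnx : IndepFun (fun ω k => n k ω) (fun ω k => x k ω) P) (k : Fin κ) :
    ∃ y, IsLinearIn (Finset.Iic k) (fun j ω => (L j)ᵀ.toEuclideanLin (x j ω) + n j ω) y ∧
      (∀ j ≤ k, crossCov P (fun ω => x k ω - y ω)
        (fun ω => (L j)ᵀ.toEuclideanLin (x j ω) + n j ω) = 0) ∧ covMat P y = H k := by
  have hP := hx.isProbabilityMeasure
  have hnL : ∀ k, MemLp (n k) 2 P := fun k =>
    (⟨by rw [hnN k]; infer_instance⟩ : HasGaussianLaw (n k) P).memLp_two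
  have hLx := fun j => (hx.memLp j).toEuclideanLin (L j)ᵀ
  have hinn : ∀ k, MemLp (innovation A x k) 2 P := fun k =>
    (hx.hasGaussianLaw_innovation k).memLp_two
  set s : Fin κ → Ω → EuclideanSpace ℝ (Fin m) :=
    fun j ω => (L j)ᵀ.toEuclideanLin (x j ω) + n j ω with hsdef
  have hs : ∀ j, MemLp (s j) 2 P := fun j => (hLx j).add (hnL j)
  have hnxz : ∀ i j, crossCov P (x i) (n j) = 0 := fun i j =>
    crossCov_eq_zero_of_indepFun
      (hnx.symm.comp (measurable_pi_apply i) (measurable_pi_apply j)) (hx.memLp i) (hnL j)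
  have hxnz : ∀ i j, crossCov P (n i) (x j) = 0 := fun i j => by
    rw [← crossCov_transpose, hnxz, Matrix.transpose_zero]
  have hws : ∀ k, ∀ j < k, crossCov P (innovation A x k) (s j) = 0 := fun k j hj => by
    have h1 : crossCov P (innovation A x k) (x j) = 0 :=
      crossCov_eq_zero_of_indepFun ((hx.indepFun_innovation k).comp measurable_id
        (measurable_pi_apply (⟨j, hj⟩ : {j : Fin κ // j < k}))) (hinn k) (hx.memLp j)
    have h2 : crossCov P (innovation A x k) (n j) = 0 := by
      refine crossCov_eq_zero_of_indepFun ?_ (hinn k) (hnL j)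
      rw [innovation_eq_comp]
      exact hnx.symm.comp (measurable_innovation A (fun k => measurable_pi_apply k) k)
        (measurable_pi_apply j)
    rw [crossCov_add_right (hinn k) (hLx j) (hnL j), crossCov_lin_right _ (hinn k) (hx.memLp j),
      h1, h2]
    simp
  have hvs : ∀ k, ∀ j < k, crossCov P (n k) (s j) = 0 := fun k j hj => by
    rw [crossCov_add_right (hnL k) (hLx j) (hnL j), crossCov_lin_right _ (hnL k) (hx.memLp j),
      hxnz, crossCov_eq_zero_of_indepFun (hni.indepFun hj.ne') (hnL k) (hnL j)]
    simp
  -- Stated with `prev`, which is zero at the first stage, so that the base case is the same update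
  -- started from the zero estimate.
  have step : ∀ (k : Fin κ) (xh : Ω → EuclideanSpace ℝ (Fin m)), MemLp (prev x k) 2 P →
      IsLinearIn (Finset.Iio k) s xh →
      (∀ j < k, crossCov P (fun ω => prev x k ω - xh ω) (s j) = 0) → covMat P xh = prev H k →
      ∃ y, IsLinearIn (Finset.Iic k) s y ∧
        (∀ j ≤ k, crossCov P (fun ω => x k ω - y ω) (s j) = 0) ∧ covMat P y = H k := by
    intro k xh hu hxh hus hB
    have e : x k = fun ω => A.toEuclideanLin (prev x k ω) + innovation A x k ω :=
      funext fun ω => eq_add_innovation A x k ω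
    have hRk := hR k
    have hMk := hM k
    have hnk := hnxz k k
    have hsk : ∀ ω, s k ω = (L k)ᵀ.toEuclideanLin
        (A.toEuclideanLin (prev x k ω) + innovation A x k ω) + n k ω := fun ω => by
      rw [← eq_add_innovation A x k ω]
    rw [e] at hRk hMk hnk
    obtain ⟨y, h1, h2, h3⟩ := exists_estimate_step hs hu (hinn k) (hnL k) hsk (hws k) (hvs k)
      hnk hxh hus hB (covMat_of_map_eq (hN k) (hn k) (hnN k)) hRk
    refine ⟨y, h1, fun j hj => ?_, ?_⟩
    · rw [← h2 j hj, e]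
    · rw [h3, hMk, add_sub_cancel]
  induction k using stage_induction with
  | zero k hk =>
    refine step k 0 ?_ .zero (fun j hj => ?_) ?_
    · rw [prev_eq_zero x hk]; exact MemLp.zero
    · exact absurd (Fin.lt_def.1 hj) (by omega)
    · rw [prev_eq_zero H hk]
      ext i j
      simp [covMat]
  | succ j k h ih =>
    obtain ⟨y, h1, h2, h3⟩ := ih
    refine step k y ?_ (h1.mono fun i hi => ?_) (fun i hi => ?_) ?_
    · rw [prev_eq x h]; exact hx.memLp j
    · rw [Finset.mem_Iic, Fin.le_def] at hi
      rw [Finset.mem_Iio, Fin.lt_def]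
      omega
    · rw [prev_eq x h]
      exact h2 i (by rw [Fin.lt_def] at hi; rw [Fin.le_def]; omega)
    · rw [prev_eq H h, h3]

/-- The covariances of the posterior estimates under linear rules. -/
theorem posteriorCov_linear (hx : IsGaussMarkov P A S₁ Sw x) (hN : ∀ k, (N k).PosSemidef)
    (hR : ∀ k, (covMat P (x k) - A * prev H k * Aᵀ) * L k =
      M k * ((L k)ᵀ * (covMat P (x k) - A * prev H k * Aᵀ) * L k + N k))
    (hM : ∀ k, (covMat P (x k) - A * prev H k * Aᵀ) * L k * (M k)ᵀ = H k - A * prev H k * Aᵀ)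
    (hn : ∀ k, Measurable (n k)) (hnN : ∀ k, P.map (n k) = multivariateGaussian 0 (N k))
    (hni : iIndepFun n P) (hnx : IndepFun (fun ω k => n k ω) (fun ω k => x k ω) P) (k : Fin κ) :
    posteriorCov P x (fun j ω => (L j)ᵀ.toEuclideanLin (x j ω) + n j ω) k = H k := by
  have hP := hx.isProbabilityMeasure
  obtain ⟨y, hy, hys, hyH⟩ := exists_linear_estimate hx hN hR hM hn hnN hni hnx k
  have hng : ∀ k, HasGaussianLaw (n k) P := fun k => ⟨by rw [hnN k]; infer_instance⟩
  have hLm := fun j => measurable_toEuclideanLin (L j)ᵀ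
  set s : Fin κ → Ω → EuclideanSpace ℝ (Fin m) :=
    fun j ω => (L j)ᵀ.toEuclideanLin (x j ω) + n j ω with hsdef
  have hs : ∀ j, MemLp (s j) 2 P := fun j =>
    ((hx.memLp j).toEuclideanLin (L j)ᵀ).add (hng j).memLp_two
  have hsm : ∀ j, Measurable (s j) := fun j => ((hLm j).comp (hx.measurable j)).add (hn j)
  have hyL : MemLp y 2 P := hy.memLp hs
  have he : MemLp (fun ω => x k ω - y ω) 2 P := (hx.memLp k).sub hyL
  obtain ⟨T, hT⟩ := hy
  have hym : Measurable[signalSigma s k] y := by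
    rw [show y = _ from funext hT]
    exact T.continuous.measurable.comp (@measurable_pi_lambda _ _ _ (signalSigma s k) _ _
      fun j => measurable_signal s (Finset.mem_Iic.1 j.2))
  -- Error and signals form a linear image of the jointly Gaussian states and noises; this is what
  -- upgrades uncorrelated to independent below.
  have hgauss : HasGaussianLaw (fun ω => (x k ω - y ω, fun j : Finset.Iic k => s j ω)) P := by
    have hj := hnx.symm.hasGaussianLaw hx.hasGaussianLaw (hni.hasGaussianLaw hng)
    let E := EuclideanSpace ℝ (Fin m)
    let S : ((Fin κ → E) × (Fin κ → E)) →L[ℝ] (Finset.Iic k → E) :=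
      ContinuousLinearMap.pi fun j : Finset.Iic k =>
        (LinearMap.toContinuousLinearMap (L j)ᵀ.toEuclideanLin).comp
          ((ContinuousLinearMap.proj (R := ℝ) (φ := fun _ : Fin κ => E) j.1).comp
            (ContinuousLinearMap.fst ℝ (Fin κ → E) (Fin κ → E))) +
        (ContinuousLinearMap.proj (R := ℝ) (φ := fun _ : Fin κ => E) j.1).comp
          (ContinuousLinearMap.snd ℝ (Fin κ → E) (Fin κ → E))
    have h := hj.map ((((ContinuousLinearMap.proj k).comp (ContinuousLinearMap.fst ℝ _ _)) -
      T.comp S).prod S)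
    convert! h using 1
    funext ω
    have hS : S (fun k => x k ω, fun k => n k ω) = fun j : Finset.Iic k => s j ω := rfl
    simp only [Function.comp, ContinuousLinearMap.prod_apply, _root_.sub_apply,
      ContinuousLinearMap.comp_apply, hS, ← hT]
    rfl
  have hind : IndepFun (fun ω => x k ω - y ω) (fun ω (j : Finset.Iic k) => s j ω) P :=
    hgauss.indepFun_of_covariance_strongDual fun f g =>
      IsLinearIn.covariance_strongDual_eq_zero he hs (fun j hj => hys j (Finset.mem_Iic.1 hj)) f g
  have hindep : Indep (MeasurableSpace.comap (fun ω => x k ω - y ω) inferInstance)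
      (signalSigma s k) P := by
    have h := hind.comp measurable_id
      (ψ := fun (t : Finset.Iic k → EuclideanSpace ℝ (Fin m)) (i : Set.Iic k) =>
        t ⟨i, Finset.mem_Iic.2 i.2⟩) (by fun_prop)
    exact (IndepFun_iff_Indep _ _ _).1 h
  have hF := signalSigma_le hsm k
  have hem : Measurable fun ω => x k ω - y ω := (hx.measurable k).sub (hym.mono hF le_rfl)
  have hc : P[fun ω => x k ω - y ω | signalSigma s k] =ᵐ[P]
      fun _ => P[fun ω => x k ω - y ω] :=
    condExp_indep_eq hem.comap_le hF (comap_measurable _).stronglyMeasurable hindep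
  -- `y` is known from the signals, and the error, being independent of them, leaves only its mean.
  have hpost : posterior P x s k =ᵐ[P] fun ω => P[fun ω => x k ω - y ω] + y ω := by
    rw [_root_.posterior, show x k = (fun ω => x k ω - y ω) + y from funext fun ω => by simp]
    refine (condExp_add (he.integrable (by norm_num)) (hyL.integrable (by norm_num)) _).trans ?_
    rw [condExp_of_stronglyMeasurable hF hym.stronglyMeasurable (hyL.integrable (by norm_num))]
    filter_upwards [hc] with ω h
    rw [Pi.add_apply, h]
    simp
  rw [posteriorCov, covMat_congr hpost, covMat_const_add _ hyL, hyH]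

/-- A criterion for linear rules to attain a sequence of covariances; `M k` is the gain of the
optimal estimator at stage `k`. -/
theorem linearRuleAttains_of_gain (hx : IsGaussMarkov P A S₁ Sw x) (hN : ∀ k, (N k).PosSemidef)
    (hR : ∀ k, (covMat P (x k) - A * prev H k * Aᵀ) * L k =
      M k * ((L k)ᵀ * (covMat P (x k) - A * prev H k * Aᵀ) * L k + N k))
    (hM : ∀ k, (covMat P (x k) - A * prev H k * Aᵀ) * L k * (M k)ᵀ = H k - A * prev H k * Aᵀ) :
    LinearRuleAttains P x L N H := by
  have hP := hx.isProbabilityMeasure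
  let J := (linearPolicy L N).jointLaw P x
  have hJ : IsProbabilityMeasure J :=
    (linearPolicy L N).isProbabilityMeasure_jointLaw (P := P) hx.measurable
  have hJx := (linearPolicy L N).isGaussMarkov_jointLaw hx
  let E := EuclideanSpace ℝ (Fin m)
  -- Noise recovered from the joint law, which reduces the policy to the case of explicitly given
  -- noise vectors.
  let n : Fin κ → (Fin κ → E) × (Fin κ → E) → E :=
    fun k z => z.2 k - (L k)ᵀ.toEuclideanLin (z.1 k)
  have hn : ∀ k, Measurable (n k) := fun k => by
    have := measurable_toEuclideanLin (L k)ᵀ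
    simp only [n]
    fun_prop
  have hnm : Measurable fun z k => n k z := measurable_pi_lambda _ hn
  have hmap := map_noise_jointLaw_linearPolicy (P := P) hx.measurable L N
  have hpX : IsProbabilityMeasure (P.map fun ω k => x k ω) :=
    Measure.isProbabilityMeasure_map (measurable_pi_lambda _ hx.measurable).aemeasurable
  have hpi : J.map (fun z k => n k z) = Measure.pi fun k => multivariateGaussian 0 (N k) := by
    have h : J.map (fun z k => n k z) = (J.map fun z => (z.1, fun k => n k z)).map Prod.snd := by
      rw [Measure.map_map measurable_snd (measurable_fst.prodMk hnm)]
      rfl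
    rw [h, hmap, ← Measure.snd, Measure.snd_prod]
  have hnN : ∀ k, J.map (n k) = multivariateGaussian 0 (N k) := fun k => by
    have h : J.map (n k) = (J.map fun z k => n k z).map (Function.eval k) := by
      rw [Measure.map_map (measurable_pi_apply k) hnm]
      rfl
    rw [h, hpi, Measure.pi_map_eval]
    simp
  have hni : iIndepFun n J := by
    rw [iIndepFun_iff_map_fun_eq_pi_map fun k => (hn k).aemeasurable, hpi]
    simp_rw [hnN]
  have hnx : IndepFun (fun z k => n k z) (fun z k => z.1 k) J := by
    refine IndepFun.symm ?_
    rw [indepFun_iff_map_prod_eq_prod_map_map measurable_fst.aemeasurable hnm.aemeasurable, hpi,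
      (linearPolicy L N).map_fst_jointLaw hx.measurable]
    exact hmap
  have hsn : ∀ k z, z.2 k = (L k)ᵀ.toEuclideanLin (z.1 k) + n k z := fun k z => by simp [n]
  refine ⟨hN, fun k => ?_, fun k => ?_, fun n hn hnN hni hnx k =>
    posteriorCov_linear hx hN hR hM hn hnN hni hnx k⟩
  · have h : HasGaussianLaw (n k) J := ⟨by rw [hnN k]; infer_instance⟩
    rw [show (fun z : (Fin κ → E) × (Fin κ → E) => z.2 k) = _ from funext fun z => hsn k z]
    exact ((hJx.memLp k).toEuclideanLin _).add h.memLp_two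
  · have h := posteriorCov_linear (P := J) (x := fun k z => z.1 k) (H := H) (M := M) (L := L) (N := N)
      hJx hN
      (fun k => by rw [(linearPolicy L N).covMat_jointLaw hx.measurable]; exact hR k)
      (fun k => by rw [(linearPolicy L N).covMat_jointLaw hx.measurable]; exact hM k)
      hn hnN hni hnx k
    simp_rw [← hsn] at h
    exact h

end LinearRules

/-! ### Spectral decomposition with positive eigenvalues first. -/

section Spectral

variable {m : ℕ}

lemma exists_orthogonal_diagonal {R : Matrix (Fin m) (Fin m) ℝ} (hR : R.IsHermitian) :
    ∃ V ∈ Matrix.orthogonalGroup (Fin m) ℝ, ∃ d : Fin m → ℝ,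
      R = V * Matrix.diagonal d * Vᵀ := by
  refine ⟨hR.eigenvectorUnitary, hR.eigenvectorUnitary.2, hR.eigenvalues, ?_⟩
  conv_lhs => rw [hR.spectral_theorem]
  rw [Unitary.conjStarAlgAut_apply, Matrix.star_eq_conjTranspose,
    Matrix.conjTranspose_eq_transpose_of_trivial]
  rfl

lemma transpose_mul_of_mem_orthogonalGroup {U : Matrix (Fin m) (Fin m) ℝ}
    (hU : U ∈ Matrix.orthogonalGroup (Fin m) ℝ) : Uᵀ * U = 1 :=
  (Matrix.mem_orthogonalGroup_iff' _ _).1 hU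

/-- The spectral theorem, with the positive eigenvalues listed first. -/
lemma exists_orthogonal_padDiagonal {R : Matrix (Fin m) (Fin m) ℝ} (hR : R.PosSemidef) :
    ∃ n ≤ m, ∃ U ∈ Matrix.orthogonalGroup (Fin m) ℝ, ∃ lam : Fin n → ℝ, (∀ i, 0 < lam i) ∧
      R = U * padDiagonal m lam * Uᵀ := by
  obtain ⟨V, hV, d, hd⟩ := exists_orthogonal_diagonal hR.isHermitian
  have hVt := transpose_mul_of_mem_orthogonalGroup hV
  have hd0 : ∀ i, 0 ≤ d i := by
    have h : (Vᵀ * R * V).PosSemidef := by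
      simpa using hR.conjTranspose_mul_mul_same V
    have e : Vᵀ * R * V = Matrix.diagonal d := by
      rw [hd, Matrix.mul_assoc, Matrix.mul_assoc, Matrix.mul_assoc, hVt, Matrix.mul_one,
        ← Matrix.mul_assoc, hVt, Matrix.one_mul]
    rw [e] at h
    intro i
    simpa using h.diag_nonneg (i := i)
  have hn : Fintype.card {i // 0 < d i} ≤ m := by
    simpa using Fintype.card_subtype_le fun i => 0 < d i
  set n := Fintype.card {i // 0 < d i} with hndef
  have hcard : Fintype.card {i : Fin m // i.val < n} = Fintype.card {i // 0 < d i} := by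
    rw [← hndef, Fintype.card_congr (Fin.castLEquiv hn).symm, Fintype.card_fin]
  -- A permutation taking the first `n` indices to those of the positive eigenvalues; the remaining
  -- eigenvalues are zero by `hd0`.
  let e := (Fintype.equivOfCardEq hcard).extendSubtype
  refine ⟨n, hn, V.submatrix id e, ?_, fun i => d (e (Fin.castLE hn i)), fun i => ?_, ?_⟩
  · rw [Matrix.mem_orthogonalGroup_iff', Matrix.transpose_submatrix,
      ← Matrix.submatrix_mul _ _ e id e Function.bijective_id, hVt, Matrix.submatrix_one_equiv]
  · exact Equiv.extendSubtype_mem (Fintype.equivOfCardEq hcard) _ i.2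
  · have hp : padDiagonal m (fun i => d (e (Fin.castLE hn i))) =
        (Matrix.diagonal d).submatrix e e := by
      rw [padDiagonal, Matrix.submatrix_diagonal_equiv]
      congr 1
      funext i
      by_cases h : i.val < n
      · simp [h]
      · simp only [h, dif_neg, not_false_eq_true, Function.comp]
        have := Equiv.extendSubtype_not_mem (Fintype.equivOfCardEq hcard) i h
        exact le_antisymm (hd0 _) (not_lt.1 this)
    rw [hp, Matrix.transpose_submatrix, Matrix.submatrix_mul_equiv, Matrix.submatrix_mul_equiv,
      Matrix.submatrix_id_id, hd]

end Spectral

/-! ### Kernels of ordered positive semidefinite matrices. -/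

section PosSemidef

variable {ι : Type*} [Fintype ι]

/-- If `R v = 0`, the quadratic form of `G` at `v` lies between zero and that of `R`, so it
vanishes, and then `G v = 0`. -/
lemma mul_eq_zero_of_posSemidef_sub {l : Type*} [Fintype l] [DecidableEq l] {R G : Matrix ι ι ℝ}
    {Q : Matrix ι l ℝ} (hG : G.PosSemidef) (hRG : (R - G).PosSemidef) (hQ : R * Q = 0) :
    G * Q = 0 := by
  refine Matrix.ext_of_mulVec_single fun i => ?_
  rw [← Matrix.mulVec_mulVec, Matrix.zero_mulVec]
  set v := Q *ᵥ Pi.single i 1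
  have hv : R *ᵥ v = 0 := by
    rw [Matrix.mulVec_mulVec, hQ, Matrix.zero_mulVec]
  have h1 := hRG.dotProduct_mulVec_nonneg v
  rw [Matrix.sub_mulVec, hv, zero_sub, dotProduct_neg] at h1
  exact (hG.dotProduct_mulVec_zero_iff v).1 (le_antisymm (by linarith) (hG.dotProduct_mulVec_nonneg v))

end PosSemidef

/-! ### Algebra of the explicit gains in whitened coordinates. -/

namespace EigenData

variable {m : ℕ} (D : EigenData m) {R G : Matrix (Fin m) (Fin m) ℝ}

lemma transpose_idZero_mul {m n : ℕ} (h : n ≤ m) : (idZero m n)ᵀ * idZero m n = 1 := by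
  ext i j
  rw [Matrix.mul_apply, Finset.sum_eq_single (Fin.castLE h i)]
  · simp [idZero, Matrix.one_apply, Fin.ext_iff]
  · intro k _ hk
    have : k.val ≠ i.val := fun e => hk (Fin.ext e)
    simp [idZero, this]
  · simp

lemma padDiagonal_eq {m n : ℕ} (v : Fin n → ℝ) :
    padDiagonal m v = idZero m n * Matrix.diagonal v * (idZero m n)ᵀ := by
  ext i j
  rw [Matrix.mul_apply]
  simp only [Matrix.mul_diagonal, padDiagonal, Matrix.diagonal_apply]
  by_cases hi : i.val < n
  · rw [Finset.sum_eq_single ⟨i.val, hi⟩]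
    · simp [idZero, hi, Fin.ext_iff, eq_comm]
    · intro k _ hk
      have : i.val ≠ k.val := fun e => hk (Fin.ext e.symm)
      simp [idZero, this]
    · simp
  · rw [Finset.sum_eq_zero]
    · simp [hi]
    · intro k _
      have : i.val ≠ k.val := fun e => hi (e ▸ k.2)
      simp [idZero, this]

/-- The matrix `U [I; O] Λ^{1/2}`, a square root of the decomposed matrix. -/
noncomputable def sqrtFactor : Matrix (Fin m) (Fin D.n) ℝ :=
  D.U * idZero m D.n * Matrix.diagonal fun i => √(D.lam i)

/-- The matrix `U [I; O] Λ^{-1/2}`. -/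
noncomputable def invFactor : Matrix (Fin m) (Fin D.n) ℝ := D.U * idZero m D.n * D.invSqrt

lemma gain_eq (v : Fin D.n → ℝ) :
    D.gain v = D.invFactor * D.Ubar * Matrix.diagonal v * (idZero m D.n)ᵀ := rfl

lemma compress_eq_mul (G : Matrix (Fin m) (Fin m) ℝ) :
    D.compress G = D.invFactorᵀ * G * D.invFactor := by
  simp only [compress, invFactor, invSqrt, Matrix.transpose_mul, Matrix.diagonal_transpose,
    Matrix.mul_assoc]

lemma posSemidef_noiseCov (sigO : Fin D.n → ℝ) :
    (D.noiseCov sigO).PosSemidef := by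
  refine Matrix.PosSemidef.diagonal fun i => ?_
  dsimp only
  split_ifs
  · exact sq_nonneg _
  · exact le_rfl

namespace Decomposes

variable {D}

lemma eq_sqrtFactor_mul (h : D.Decomposes R G) : R = D.sqrtFactor * D.sqrtFactorᵀ := by
  have e : Matrix.diagonal D.lam =
      (Matrix.diagonal fun i => √(D.lam i)) * Matrix.diagonal fun i => √(D.lam i) := by
    rw [Matrix.diagonal_mul_diagonal]
    congr 1
    funext i
    exact (Real.mul_self_sqrt (h.lam_pos i).le).symm
  rw [h.eq, padDiagonal_eq, e]
  simp only [sqrtFactor, Matrix.transpose_mul, Matrix.diagonal_transpose, Matrix.mul_assoc]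

lemma transpose_idZero_mul_orthogonal (h : D.Decomposes R G) :
    (D.U * idZero m D.n)ᵀ * (D.U * idZero m D.n) = 1 := by
  rw [Matrix.transpose_mul, Matrix.mul_assoc, ← Matrix.mul_assoc D.Uᵀ,
    transpose_mul_of_mem_orthogonalGroup h.orthogonal, Matrix.one_mul,
    transpose_idZero_mul D.n_le]

lemma transpose_sqrtFactor_mul (h : D.Decomposes R G) : D.sqrtFactorᵀ * D.invFactor = 1 := by
  rw [sqrtFactor, invFactor, Matrix.transpose_mul, Matrix.mul_assoc, ← Matrix.mul_assoc _ᵀ _ D.invSqrt,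
    h.transpose_idZero_mul_orthogonal, Matrix.one_mul, invSqrt, Matrix.diagonal_transpose,
    Matrix.diagonal_mul_diagonal, ← Matrix.diagonal_one]
  congr 1
  funext i
  exact mul_inv_cancel₀ (Real.sqrt_pos.2 (h.lam_pos i)).ne'

lemma transpose_invFactor_mul (h : D.Decomposes R G) : D.invFactorᵀ * D.sqrtFactor = 1 := by
  rw [← Matrix.transpose_transpose D.sqrtFactor, ← Matrix.transpose_mul,
    h.transpose_sqrtFactor_mul, Matrix.transpose_one]

/-- Nothing is lost by compressing: `G` vanishes on the kernel of `R`, so whitening and then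
unwhitening restores it even for singular `R`. -/
lemma mul_transpose_eq (h : D.Decomposes R G) (hG : G.PosSemidef) (hRG : (R - G).PosSemidef) :
    D.sqrtFactor * D.compress G * D.sqrtFactorᵀ = G := by
  -- The complementary factor projects onto the kernel of `R`.
  have hQ : R * (1 - D.invFactor * D.sqrtFactorᵀ) = 0 := by
    rw [h.eq_sqrtFactor_mul, Matrix.mul_sub, Matrix.mul_one, Matrix.mul_assoc,
      ← Matrix.mul_assoc D.sqrtFactorᵀ, h.transpose_sqrtFactor_mul, Matrix.one_mul, sub_self]
  have h1 := mul_eq_zero_of_posSemidef_sub hG hRG hQ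
  rw [Matrix.mul_sub, Matrix.mul_one, sub_eq_zero] at h1
  have hGt : Gᵀ = G := by
    have := hG.isHermitian
    rwa [Matrix.IsHermitian, Matrix.conjTranspose_eq_transpose_of_trivial] at this
  have h2 : D.sqrtFactor * D.invFactorᵀ * G = G := by
    have := congrArg Matrix.transpose h1
    rw [Matrix.transpose_mul, Matrix.transpose_mul, Matrix.transpose_transpose, hGt] at this
    exact this.symm
  calc D.sqrtFactor * D.compress G * D.sqrtFactorᵀ
      = D.sqrtFactor * D.invFactorᵀ * (G * (D.invFactor * D.sqrtFactorᵀ)) := by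
        rw [compress_eq_mul]
        simp only [Matrix.mul_assoc]
    _ = G := by rw [← h1, h2]

lemma diagonal_lamBar (h : D.Decomposes R G) :
    Matrix.diagonal D.lamBar = (D.invFactor * D.Ubar)ᵀ * G * (D.invFactor * D.Ubar) := by
  have ho := transpose_mul_of_mem_orthogonalGroup h.orthogonal_bar
  have hc := h.compress_eq
  rw [compress_eq_mul] at hc
  calc Matrix.diagonal D.lamBar
      = D.Ubarᵀ * D.Ubar * Matrix.diagonal D.lamBar * (D.Ubarᵀ * D.Ubar) := by rw [ho]; simp
    _ = D.Ubarᵀ * (D.Ubar * Matrix.diagonal D.lamBar * D.Ubarᵀ) * D.Ubar := by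
        simp only [Matrix.mul_assoc]
    _ = _ := by
        rw [← hc]
        simp only [Matrix.mul_assoc, Matrix.transpose_mul]

/-- Congruence by `D.invFactor * D.Ubar` turns `R` into the identity and `G` into `diagonal
D.lamBar`, so the bounds on `G` become bounds on the diagonal entries. -/
lemma lamBar_mem (h : D.Decomposes R G) (hG : G.PosSemidef) (hRG : (R - G).PosSemidef)
    (i : Fin D.n) : D.lamBar i ∈ Set.Icc (0 : ℝ) 1 := by
  have h0 : (Matrix.diagonal D.lamBar).PosSemidef := by
    rw [h.diagonal_lamBar]
    simpa using hG.conjTranspose_mul_mul_same (D.invFactor * D.Ubar)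
  have hR : (D.invFactor * D.Ubar)ᵀ * R * (D.invFactor * D.Ubar) = 1 := by
    rw [h.eq_sqrtFactor_mul, Matrix.transpose_mul]
    calc D.Ubarᵀ * D.invFactorᵀ * (D.sqrtFactor * D.sqrtFactorᵀ) * (D.invFactor * D.Ubar)
        = D.Ubarᵀ * (D.invFactorᵀ * D.sqrtFactor) * (D.sqrtFactorᵀ * D.invFactor) * D.Ubar := by
          simp only [Matrix.mul_assoc]
      _ = 1 := by
          rw [h.transpose_invFactor_mul, h.transpose_sqrtFactor_mul, Matrix.mul_one,
            Matrix.mul_one, transpose_mul_of_mem_orthogonalGroup h.orthogonal_bar]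
  have h1 : (1 - Matrix.diagonal D.lamBar).PosSemidef := by
    rw [h.diagonal_lamBar, ← hR, ← Matrix.sub_mul, ← Matrix.mul_sub]
    simpa using hRG.conjTranspose_mul_mul_same (D.invFactor * D.Ubar)
  have a := h0.diag_nonneg (i := i)
  have b := h1.diag_nonneg (i := i)
  simp at a b
  exact ⟨a, b⟩

/-- The gain of the optimal estimator for the rule given by the eigen-decompositions. -/
noncomputable def _root_.EigenData.estimatorGain (D : EigenData m) (lamO sigO : Fin D.n → ℝ) :
    Matrix (Fin m) (Fin m) ℝ :=
  D.sqrtFactor * D.Ubar * Matrix.diagonal (fun i => lamO i / (lamO i ^ 2 + sigO i ^ 2)) *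
    (idZero m D.n)ᵀ

lemma mul_gain (h : D.Decomposes R G) (lamO : Fin D.n → ℝ) :
    R * D.gain lamO = D.sqrtFactor * D.Ubar * Matrix.diagonal lamO * (idZero m D.n)ᵀ := by
  rw [h.eq_sqrtFactor_mul, gain_eq]
  calc D.sqrtFactor * D.sqrtFactorᵀ *
        (D.invFactor * D.Ubar * Matrix.diagonal lamO * (idZero m D.n)ᵀ)
      = D.sqrtFactor * (D.sqrtFactorᵀ * D.invFactor) *
          (D.Ubar * Matrix.diagonal lamO * (idZero m D.n)ᵀ) := by simp only [Matrix.mul_assoc]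
    _ = _ := by
      rw [h.transpose_sqrtFactor_mul, Matrix.mul_one]
      simp only [Matrix.mul_assoc]

/-- Since the gain whitens the prediction error and rotates it by `Ubar`, the unpredicted part of
the signal has a diagonal covariance. -/
lemma gain_mul_add (h : D.Decomposes R G) (lamO sigO : Fin D.n → ℝ) :
    (D.gain lamO)ᵀ * R * D.gain lamO + D.noiseCov sigO =
      idZero m D.n * Matrix.diagonal (fun i => lamO i ^ 2 + sigO i ^ 2) * (idZero m D.n)ᵀ := by
  have e : (D.gain lamO)ᵀ * R * D.gain lamO =
      idZero m D.n * Matrix.diagonal (fun i => lamO i ^ 2) * (idZero m D.n)ᵀ := by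
    have hd : Matrix.diagonal (fun i => lamO i ^ 2) =
        Matrix.diagonal lamO * Matrix.diagonal lamO := by
      rw [Matrix.diagonal_mul_diagonal]
      simp only [sq]
    rw [Matrix.mul_assoc, h.mul_gain, gain_eq, hd]
    simp only [Matrix.transpose_mul, Matrix.transpose_transpose, Matrix.diagonal_transpose]
    calc idZero m D.n * (Matrix.diagonal lamO * (D.Ubarᵀ * D.invFactorᵀ)) *
          (D.sqrtFactor * D.Ubar * Matrix.diagonal lamO * (idZero m D.n)ᵀ)
        = idZero m D.n * Matrix.diagonal lamO *
          (D.Ubarᵀ * ((D.invFactorᵀ * D.sqrtFactor) * D.Ubar)) *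
          (Matrix.diagonal lamO * (idZero m D.n)ᵀ) := by simp only [Matrix.mul_assoc]
      _ = _ := by
        rw [h.transpose_invFactor_mul, Matrix.one_mul,
          transpose_mul_of_mem_orthogonalGroup h.orthogonal_bar, Matrix.mul_one]
        simp only [Matrix.mul_assoc]
  rw [e, noiseCov, padDiagonal_eq, ← Matrix.add_mul, ← Matrix.mul_add,
    Matrix.diagonal_add]

/-- The normal equation of the estimator. It decouples into scalar identities, and `hs` allows the
division in each of them. -/
lemma mul_gain_eq (h : D.Decomposes R G) {lamO sigO : Fin D.n → ℝ}
    (hs : ∀ i, lamO i ^ 2 + sigO i ^ 2 ≠ 0) :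
    R * D.gain lamO =
      D.estimatorGain lamO sigO * ((D.gain lamO)ᵀ * R * D.gain lamO + D.noiseCov sigO) := by
  rw [h.gain_mul_add, h.mul_gain, estimatorGain]
  calc D.sqrtFactor * D.Ubar * Matrix.diagonal lamO * (idZero m D.n)ᵀ
      = D.sqrtFactor * D.Ubar * (Matrix.diagonal (fun i => lamO i / (lamO i ^ 2 + sigO i ^ 2)) *
        (((idZero m D.n)ᵀ * idZero m D.n) *
          Matrix.diagonal (fun i => lamO i ^ 2 + sigO i ^ 2))) * (idZero m D.n)ᵀ := by
        rw [transpose_idZero_mul D.n_le, Matrix.one_mul, Matrix.diagonal_mul_diagonal]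
        congr 4
        funext i
        exact (div_mul_cancel₀ _ (hs i)).symm
    _ = _ := by simp only [Matrix.mul_assoc]

/-- The product of the signal gain and the estimator gain in each coordinate is the prescribed
eigenvalue, so the increment unwhitens to `G`. -/
lemma mul_gain_mul_estimatorGain (h : D.Decomposes R G) (hG : G.PosSemidef)
    (hRG : (R - G).PosSemidef) {lamO sigO : Fin D.n → ℝ}
    (hs : ∀ i, lamO i ^ 2 / (lamO i ^ 2 + sigO i ^ 2) = D.lamBar i) :
    R * D.gain lamO * (D.estimatorGain lamO sigO)ᵀ = G := by
  rw [h.mul_gain, estimatorGain]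
  simp only [Matrix.transpose_mul, Matrix.transpose_transpose, Matrix.diagonal_transpose]
  calc D.sqrtFactor * D.Ubar * Matrix.diagonal lamO * (idZero m D.n)ᵀ *
        (idZero m D.n * (Matrix.diagonal (fun i => lamO i / (lamO i ^ 2 + sigO i ^ 2)) *
          (D.Ubarᵀ * D.sqrtFactorᵀ)))
      = D.sqrtFactor * (D.Ubar * (Matrix.diagonal lamO * (((idZero m D.n)ᵀ * idZero m D.n) *
        Matrix.diagonal (fun i => lamO i / (lamO i ^ 2 + sigO i ^ 2)))) * D.Ubarᵀ) *
          D.sqrtFactorᵀ := by simp only [Matrix.mul_assoc]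
    _ = D.sqrtFactor * (D.Ubar * Matrix.diagonal D.lamBar * D.Ubarᵀ) * D.sqrtFactorᵀ := by
      rw [transpose_idZero_mul D.n_le, Matrix.one_mul, Matrix.diagonal_mul_diagonal]
      congr 5
      funext i
      rw [← hs i]
      ring
    _ = G := by rw [← h.compress_eq, h.mul_transpose_eq hG hRG]

end Decomposes

lemma exists_decomposes (hR : R.PosSemidef) (hG : G.IsHermitian) :
    ∃ D : EigenData m, D.Decomposes R G := by
  obtain ⟨n, hn, U, hU, lam, hlam, h⟩ := exists_orthogonal_padDiagonal hR
  -- The zeros are placeholders: `compress` reads only the first decomposition.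
  let D₀ : EigenData m := ⟨n, hn, U, lam, 0, 0⟩
  have hc : (D₀.compress G).IsHermitian := by
    rw [compress_eq_mul]
    simpa using Matrix.isHermitian_conjTranspose_mul_mul D₀.invFactor hG
  obtain ⟨V, hV, d, hd⟩ := exists_orthogonal_diagonal hc
  exact ⟨⟨n, hn, U, lam, V, d⟩, hU, hlam, h, hV, hd⟩

end EigenData

/-! ### Compactness of the feasible set. -/

section Feasible

variable {m κ : ℕ} {A : Matrix (Fin m) (Fin m) ℝ} {S H : Fin κ → Matrix (Fin m) (Fin m) ℝ}

lemma isClosed_setOf_posSemidef {ι : Type*} [Fintype ι] :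
    IsClosed {M : Matrix ι ι ℝ | M.PosSemidef} := by
  classical
  simp_rw [Matrix.posSemidef_iff_dotProduct_mulVec, Set.ofPred_and, Set.ofPred_forall]
  refine IsClosed.inter (isClosed_eq (by fun_prop) continuous_id)
    (isClosed_iInter fun v => isClosed_le continuous_const ?_)
  exact continuous_const.dotProduct (continuous_id.matrix_mulVec continuous_const)

lemma continuous_prev {M : Type*} [Zero M] [TopologicalSpace M] (k : Fin κ) :
    Continuous fun f : Fin κ → M => prev f k := by
  unfold prev
  split_ifs
  · exact continuous_apply _
  · exact continuous_const

lemma posSemidef_of_mem_feasible (hH : H ∈ feasible A S) (k : Fin κ) : (H k).PosSemidef := by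
  have step : ∀ k, (prev H k).PosSemidef → (H k).PosSemidef := fun k h => by
    have h1 := h.mul_mul_conjTranspose_same A
    rw [Matrix.conjTranspose_eq_transpose_of_trivial] at h1
    simpa using (hH k).2.add h1
  induction k using stage_induction with
  | zero k hk => exact step k (by rw [prev_eq_zero H hk]; exact .zero)
  | succ j k h ih => exact step k (by rwa [prev_eq H h])

/-- Test the quadratic form on the sum and the difference of two basis vectors. -/
lemma abs_apply_le_of_posSemidef {ι : Type*} [Fintype ι] {M : Matrix ι ι ℝ} (hM : M.PosSemidef)
    (i j : ι) : |M i j| ≤ (M i i + M j j) / 2 := by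
  classical
  have hs : M j i = M i j := by simpa using hM.isHermitian.apply i j
  have h1 := hM.dotProduct_mulVec_nonneg (Pi.single i 1 + Pi.single j 1)
  have h2 := hM.dotProduct_mulVec_nonneg (Pi.single i 1 - Pi.single j 1)
  simp [Matrix.mulVec_add, Matrix.mulVec_sub, hs] at h1 h2
  rw [abs_le]
  constructor <;> linarith

/-- Feasible matrices are positive semidefinite with diagonal at most that of `S k`, which bounds
all entries; the constraints are closed. -/
lemma isCompact_feasible : IsCompact (feasible A S) := by
  let B : Fin κ → Matrix (Fin m) (Fin m) ℝ → Prop := fun k M =>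
    ∀ i j, M i j ∈ Set.Icc (-((S k i i + S k j j) / 2)) ((S k i i + S k j j) / 2)
  have hB : IsCompact {H : Fin κ → Fin m → Fin m → ℝ | ∀ k, B k (H k)} := by
    have h : {H : Fin κ → Fin m → Fin m → ℝ | ∀ k, B k (H k)} =
        Set.univ.pi fun k => Set.univ.pi fun i => Set.univ.pi fun j =>
          Set.Icc (-((S k i i + S k j j) / 2)) ((S k i i + S k j j) / 2) := by
      ext H
      simp only [B, Set.mem_ofPred_eq, Set.mem_pi, Set.mem_univ, true_imp_iff]
    rw [h]
    exact isCompact_univ_pi fun k => isCompact_univ_pi fun i => isCompact_univ_pi fun j =>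
      isCompact_Icc
  refine IsCompact.of_isClosed_subset hB ?_ ?_
  · have h : feasible A S = ⋂ k, ((fun H => S k - H k) ⁻¹' {M | M.PosSemidef} ∩
        (fun H => H k - A * prev H k * Aᵀ) ⁻¹' {M | M.PosSemidef}) := by
      ext H
      simp [feasible]
    rw [h]
    refine isClosed_iInter fun k => ?_
    have hp := continuous_prev (κ := κ) (M := Matrix (Fin m) (Fin m) ℝ) k
    exact (isClosed_setOf_posSemidef.preimage (by fun_prop)).inter
      (isClosed_setOf_posSemidef.preimage (by fun_prop))
  · intro H hH k i j
    have h := abs_apply_le_of_posSemidef (posSemidef_of_mem_feasible hH k) i j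
    have hi := (hH k).1.diag_nonneg (i := i)
    have hj := (hH k).1.diag_nonneg (i := j)
    simp only [Matrix.sub_apply] at hi hj
    rw [Set.mem_Icc, ← abs_le]
    linarith

lemma continuous_sdpObjective (V : Matrix (Fin m) (Fin m) ℝ) :
    Continuous (sdpObjective (κ := κ) V) := by
  unfold sdpObjective
  refine continuous_finsetSum _ fun k _ => Continuous.matrix_trace ?_
  fun_prop

end Feasible

/-! ### Realization by linear rules and equivalence with the semidefinite program. -/

section Attainment

variable {Ω : Type*} [MeasurableSpace Ω] {P : Measure Ω} {m κ : ℕ}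
  {A S₁ Sw : Matrix (Fin m) (Fin m) ℝ} {x : Fin κ → Ω → EuclideanSpace ℝ (Fin m)}
  {H : Fin κ → Matrix (Fin m) (Fin m) ℝ}

lemma posSemidef_sub_of_mem_feasible {S : Fin κ → Matrix (Fin m) (Fin m) ℝ}
    (hH : H ∈ feasible A S) (k : Fin κ) :
    ((S k - A * prev H k * Aᵀ) - (H k - A * prev H k * Aᵀ)).PosSemidef := by
  rw [sub_sub_sub_cancel_right]
  exact (hH k).1

lemma exists_eigenData (hH : H ∈ feasible A fun k => covMat P (x k)) :
    ∃ D : Fin κ → EigenData m, ∀ k, (D k).Decomposes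
      (covMat P (x k) - A * prev H k * Aᵀ) (H k - A * prev H k * Aᵀ) := by
  choose D hD using fun k => EigenData.exists_decomposes
    (R := covMat P (x k) - A * prev H k * Aᵀ) (G := H k - A * prev H k * Aᵀ)
    (by simpa using (hH k).1.add (hH k).2) (hH k).2.isHermitian
  exact ⟨D, hD⟩

theorem linearRuleAttains_of_decomposes (hx : IsGaussMarkov P A S₁ Sw x)
    (hH : H ∈ feasible A fun k => covMat P (x k)) (D : Fin κ → EigenData m)
    (hD : ∀ k, (D k).Decomposes (covMat P (x k) - A * prev H k * Aᵀ)
      (H k - A * prev H k * Aᵀ)) (lamO sigO : ∀ k, Fin (D k).n → ℝ)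
    (h : ∀ k i, lamO k i ^ 2 + sigO k i ^ 2 ≠ 0 ∧
      lamO k i ^ 2 / (lamO k i ^ 2 + sigO k i ^ 2) = (D k).lamBar i) :
    LinearRuleAttains P x (fun k => (D k).gain (lamO k)) (fun k => (D k).noiseCov (sigO k)) H :=
  linearRuleAttains_of_gain (M := fun k => (D k).estimatorGain (lamO k) (sigO k)) hx
    (fun k => (D k).posSemidef_noiseCov _)
    (fun k => (hD k).mul_gain_eq fun i => (h k i).1)
    fun k => (hD k).mul_gain_mul_estimatorGain (hH k).2 (posSemidef_sub_of_mem_feasible hH k)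
      fun i => (h k i).2

theorem exists_linearRuleAttains (hx : IsGaussMarkov P A S₁ Sw x)
    (hH : H ∈ feasible A fun k => covMat P (x k)) :
    ∃ L N : Fin κ → Matrix (Fin m) (Fin m) ℝ, LinearRuleAttains P x L N H := by
  obtain ⟨D, hD⟩ := exists_eigenData hH
  have hl : ∀ k i, (D k).lamBar i ∈ Set.Icc (0 : ℝ) 1 := fun k =>
    (hD k).lamBar_mem (hH k).2 (posSemidef_sub_of_mem_feasible hH k)
  -- Normalized so that the squared gain and the noise variance sum to one; the fraction is then the
  -- eigenvalue itself.
  refine ⟨_, _, linearRuleAttains_of_decomposes hx hH D hD (fun k i => √((D k).lamBar i))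
    (fun k i => √(1 - (D k).lamBar i)) fun k i => ?_⟩
  rw [Real.sq_sqrt (hl k i).1, Real.sq_sqrt (sub_nonneg.2 (hl k i).2)]
  simp

lemma SignalingPolicy.cost_eq {𝒮 : Type*} [MeasurableSpace 𝒮] (hx : IsGaussMarkov P A S₁ Sw x)
    {p : ℕ} (Q K : Matrix (Fin p) (Fin m) ℝ) (η : SignalingPolicy m κ 𝒮) :
    SignalingPolicy.cost P x Q K η =
      sdpObjective (Kᵀ * K - Kᵀ * Q - Qᵀ * K) (η.estimateCov P x) +
        ∑ k, (Qᵀ * Q * covMat P (x k)).trace := by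
  have hP := hx.isProbabilityMeasure
  have hJ := η.isProbabilityMeasure_jointLaw (P := P) hx.measurable
  have hJx := η.isGaussMarkov_jointLaw hx
  rw [SignalingPolicy.cost, sdpObjective, ← Finset.sum_add_distrib]
  refine Finset.sum_congr rfl fun k _ => ?_
  rw [← η.covMat_jointLaw hx.measurable]
  have hF := signalSigma_le (Ω := (Fin κ → EuclideanSpace ℝ (Fin m)) × (Fin κ → 𝒮))
    (s := fun k p => p.2 k) (fun k => by fun_prop) k
  exact integral_norm_sq_sub_condExp hF (hJx.memLp k) (hJx.integral_eq_zero k) Q K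

end Attainment

theorem theorem2 {Ω : Type*} [MeasurableSpace Ω] (P : Measure Ω) [IsProbabilityMeasure P]
    {m κ : ℕ} (A S₁ Sw : Matrix (Fin m) (Fin m) ℝ)
    (x : Fin κ → Ω → EuclideanSpace ℝ (Fin m)) (hx : IsGaussMarkov P A S₁ Sw x) :
    -- the necessary condition, for arbitrary stochastic kernels
    (∀ (𝒮 : Type*) [MeasurableSpace 𝒮] (η : SignalingPolicy m κ 𝒮),
      η.estimateCov P x ∈ feasible A (fun k => covMat P (x k))) ∧
    -- the sufficiency, with memoryless linear rules
    (∀ H ∈ feasible A (fun k => covMat P (x k)),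
      (∃ L N : Fin κ → Matrix (Fin m) (Fin m) ℝ, LinearRuleAttains P x L N H) ∧
      -- the explicit form of the rules
      (∃ D : Fin κ → EigenData m, ∀ k,
        (D k).Decomposes (covMat P (x k) - A * prev H k * Aᵀ) (H k - A * prev H k * Aᵀ)) ∧
      (∀ D : Fin κ → EigenData m,
        (∀ k, (D k).Decomposes (covMat P (x k) - A * prev H k * Aᵀ)
          (H k - A * prev H k * Aᵀ)) →
        (∀ k i, (D k).lamBar i ∈ Set.Icc (0 : ℝ) 1) ∧
        ∀ lamO sigO : ∀ k, Fin (D k).n → ℝ,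
          (∀ k i, lamO k i ^ 2 + sigO k i ^ 2 ≠ 0 ∧
            lamO k i ^ 2 / (lamO k i ^ 2 + sigO k i ^ 2) = (D k).lamBar i) →
          LinearRuleAttains P x (fun k => (D k).gain (lamO k))
            (fun k => (D k).noiseCov (sigO k)) H)) ∧
    -- the equivalence with the semidefinite program
    ((fun η : SignalingPolicy m κ (EuclideanSpace ℝ (Fin m)) => η.estimateCov P x) ''
        policies P x = feasible A (fun k => covMat P (x k))) ∧
    (∀ (p : ℕ) (Q K : Matrix (Fin p) (Fin m) ℝ),
      (∀ η ∈ policies P x, SignalingPolicy.cost P x Q K η =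
        sdpObjective (Kᵀ * K - Kᵀ * Q - Qᵀ * K) (η.estimateCov P x) +
          ∑ k, (Qᵀ * Q * covMat P (x k)).trace) ∧
      (∀ η ∈ policies P x,
        IsMinOn (SignalingPolicy.cost P x Q K) (policies P x) η ↔
          IsMinOn (sdpObjective (Kᵀ * K - Kᵀ * Q - Qᵀ * K))
            (feasible A (fun k => covMat P (x k))) (η.estimateCov P x)) ∧
      (∃ L N : Fin κ → Matrix (Fin m) (Fin m) ℝ, (∀ k, (N k).PosSemidef) ∧
        linearPolicy L N ∈ policies P x ∧
        IsMinOn (SignalingPolicy.cost P x Q K) (policies P x) (linearPolicy L N))) := by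
  have hmem : ∀ η : SignalingPolicy m κ (EuclideanSpace ℝ (Fin m)),
      η.estimateCov P x ∈ feasible A fun k => covMat P (x k) := fun η =>
    η.estimateCov_mem_feasible hx
  have himage : (fun η : SignalingPolicy m κ (EuclideanSpace ℝ (Fin m)) => η.estimateCov P x) ''
      policies P x = feasible A fun k => covMat P (x k) := by
    refine Set.Subset.antisymm (Set.image_subset_iff.2 fun η _ => hmem η) fun H hH => ?_
    obtain ⟨L, N, h⟩ := exists_linearRuleAttains hx hH
    exact ⟨linearPolicy L N, h.mem_policies, funext h.estimateCov_eq⟩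
  refine ⟨fun 𝒮 _ η => η.estimateCov_mem_feasible hx, fun H hH =>
    ⟨exists_linearRuleAttains hx hH, exists_eigenData hH, fun D hD =>
      ⟨fun k => (hD k).lamBar_mem (hH k).2 (posSemidef_sub_of_mem_feasible hH k),
        linearRuleAttains_of_decomposes hx hH D hD⟩⟩, himage, fun p Q K => ?_⟩
  -- Cost and objective differ by a constant of the state process, and minimizing over the image is
  -- minimizing over policies.
  have hmin : ∀ η : SignalingPolicy m κ (EuclideanSpace ℝ (Fin m)),
      IsMinOn (SignalingPolicy.cost P x Q K) (policies P x) η ↔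
        IsMinOn (sdpObjective (Kᵀ * K - Kᵀ * Q - Qᵀ * K))
          (feasible A fun k => covMat P (x k)) (η.estimateCov P x) := fun η => by
    rw [isMinOn_iff, isMinOn_iff, ← himage, Set.forall_mem_image]
    simp only [SignalingPolicy.cost_eq hx, add_le_add_iff_right]
  refine ⟨fun η _ => SignalingPolicy.cost_eq hx Q K η, fun η _ => hmin η, ?_⟩
  -- The feasible set is nonempty by the necessary condition itself, applied to the uninformative
  -- policy with zero gain and zero noise parameter.
  obtain ⟨H, hH, hHmin⟩ := isCompact_feasible.exists_isMinOn ⟨_, hmem (linearPolicy 0 0)⟩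
    (continuous_sdpObjective (Kᵀ * K - Kᵀ * Q - Qᵀ * K)).continuousOn
  obtain ⟨L, N, h⟩ := exists_linearRuleAttains hx hH
  refine ⟨L, N, h.posSemidef, h.mem_policies, (hmin _).2 ?_⟩
  rw [show (linearPolicy L N).estimateCov P x = H from funext h.estimateCov_eq]
  exact hHmin
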